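/- Theorem. A \emph{numerical semigroup} is a subset $S\subseteq\mathbb N$ that contains $0$, is closed under addition and has finite complement in $\mathbb N$. Its set $G(S)=\{n_1<\dots<n_k\}$ of minimal generators consists of the nonzero elements of $S$ that are not a sum of two nonzero elements of $S$; $n_1$ is the \emph{multiplicity} of $S$. The semigroup $S$ is an \emph{Arf semigroup} if for every $n\in S$ the set $S(n)=\{s-n : s\in S,\ s\ge n\}$ is also a numerical semigroup. The \emph{blowup} $S'$ of $S$ is the semigroup generated by $n_1,\,n_2-n_1,\dots,n_k-n_1$. Let $\mathbb k$ be a field. For a numerical semigroup $S$ with $G(S)=\{n_1,\dots,n_k\}$ let $T=\mathbb k[X_1,\dots,X_k]$ be graded by $\deg X_j=n_j$. The semigroup ring $\mathbb k[S]=\mathbb k[t^{n_1},\dots,t^{n_k}]$, graded by $\deg t=1$, is a graded $T$-module through $X_j\mapsto t^{n_j}$, and $\mathbb k=T/(X_1,\dots,X_k)$ is a graded $T$-module. For an integer $i\ge 0$ and $s\in\mathbb Z$ put $\beta_{i,s}(S)=\dim_{\mathbb k}\operatorname{Tor}_i^T(\mathbb k[S],\mathbb k)_s$, the dimension of the part of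 degree $s$ for the induced grading. Let $S$ be an Arf semigroup of multiplicity $n_1$ whose blowup $S'$ has the same multiplicity $n_1$. Then $$\beta_{i,s}(S')=\beta_{i,\,s+(i+1)n_1}(S)$$ for all integers $i\ge 0$ and $s\in\mathbb Z$ other than $(i,s)=(0,0)$ and $(i,s)=(0,-n_1)$. In particular the equality holds for all $i\ge 1$ and all $s\in\mathbb Z$. -/

import Mathlib

open MvPolynomial TensorProduct

universe u v

noncomputable section

/-! ### Numerical semigroups, Arf semigroups, blowups -/

/-- A numerical semigroup: a subset of `ℕ` that contains `0`, is closed under addition and has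
finite complement. -/
structure IsNumericalSemigroup (A : Set ℕ) : Prop where
  zero_mem : 0 ∈ A
  add_mem : ∀ a ∈ A, ∀ b ∈ A, a + b ∈ A
  finite_compl : Aᶜ.Finite

/-- `S(n) = {s - n : s ∈ S, s ≥ n}`. -/
def shiftedSet (S : AddSubmonoid ℕ) (n : ℕ) : Set ℕ :=
  {m | ∃ s ∈ S, n ≤ s ∧ m = s - n}

/-- An Arf semigroup: a numerical semigroup `S` such that `S(n)` is a numerical semigroup for
every `n ∈ S`. -/
def IsArfSemigroup (S : AddSubmonoid ℕ) : Prop :=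
  IsNumericalSemigroup (S : Set ℕ) ∧ ∀ n ∈ S, IsNumericalSemigroup (shiftedSet S n)

/-- The minimal generators `G(S)`: the nonzero elements of `S` that are not a sum of two nonzero
elements of `S`. -/
def minGens (S : AddSubmonoid ℕ) : Set ℕ :=
  {g | g ∈ S ∧ g ≠ 0 ∧ ¬ ∃ a ∈ S, ∃ b ∈ S, a ≠ 0 ∧ b ≠ 0 ∧ g = a + b}

/-- The multiplicity: the smallest minimal generator. -/
def semigroupMultiplicity (S : AddSubmonoid ℕ) : ℕ :=
  sInf (minGens S)

/-- The blowup: the semigroup generated by `n₁, n₂ - n₁, …, n_k - n₁`, where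
`n₁ < ⋯ < n_k` are the minimal generators. (The set below also lists `n₁ - n₁ = 0`.) -/
def blowup (S : AddSubmonoid ℕ) : AddSubmonoid ℕ :=
  AddSubmonoid.closure
    (insert (semigroupMultiplicity S) ((fun g => g - semigroupMultiplicity S) '' minGens S))

/-! ### Graded free resolutions over a weighted polynomial ring -/

/-- The degree `e` part of the graded free module `⨁_b T(-deg b)` over `T = k[X_j : j ∈ σ]`,
`X_j` of degree `w j`: the basis element `b` is homogeneous of degree `deg b`. -/
def freeDegree (k : Type u) [Field k] {σ : Type v} (w : σ → ℤ) {ι : Type*} (deg : ι → ℤ)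
    (e : ℤ) : Submodule k (ι →₀ MvPolynomial σ k) where
  carrier := {f | ∀ b, f b ∈ weightedHomogeneousSubmodule k w (e - deg b)}
  add_mem' hf hg b := Submodule.add_mem _ (hf b) (hg b)
  zero_mem' _ := Submodule.zero_mem _
  smul_mem' c _ hf b := Submodule.smul_mem _ c (hf b)

/-- A graded free resolution `⋯ → F₁ → F₀ → N → 0` of a graded `T`-module `N = ⨁_d 𝓝 d`, with
`F_n` free on the homogeneous basis `ι n`; all maps are homogeneous of degree `0`. -/
structure GradedFreeResolution (k : Type u) [Field k] {σ : Type v} (w : σ → ℤ)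
    (N : Type*) [AddCommGroup N] [Module (MvPolynomial σ k) N] [Module k N]
    (𝓝 : ℤ → Submodule k N) where
  ι : ℕ → Type (max u v)
  deg : ∀ n, ι n → ℤ
  d : ∀ n, (ι (n + 1) →₀ MvPolynomial σ k) →ₗ[MvPolynomial σ k] (ι n →₀ MvPolynomial σ k)
  ε : (ι 0 →₀ MvPolynomial σ k) →ₗ[MvPolynomial σ k] N
  d_degree : ∀ n b, d n (Finsupp.single b 1) ∈ freeDegree k w (deg n) (deg (n + 1) b)
  ε_degree : ∀ b, ε (Finsupp.single b 1) ∈ 𝓝 (deg 0 b)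
  ε_surjective : Function.Surjective ε
  exact_ε : Function.Exact (d 0) ε
  exact_d : ∀ n, Function.Exact (d (n + 1)) (d n)

/-- The residue field `k = T / (X_j : j ∈ σ)` as a `T`-module. -/
abbrev ResidueModule (k : Type u) [Field k] (σ : Type v) : Type (max u v) :=
  MvPolynomial σ k ⧸ Ideal.span (Set.range (X : σ → MvPolynomial σ k))

/-- The grading of the residue field induced by that of `T`. -/
def residueDegree (k : Type u) [Field k] {σ : Type v} (w : σ → ℤ) (e : ℤ) :
    Submodule k (ResidueModule k σ) :=
  (weightedHomogeneousSubmodule k w e).map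
    (Ideal.Quotient.mkₐ k (Ideal.span (Set.range (X : σ → MvPolynomial σ k)))).toLinearMap

/-! The residue field has a graded free resolution. -/

section Existence

variable {k : Type u} [Field k] {σ : Type v} {w : σ → ℤ}

theorem iSup_freeDegree {ι : Type*} (deg : ι → ℤ) : ⨆ e, freeDegree k w deg e = ⊤ := by
  classical
  rw [eq_top_iff]
  rintro f -
  induction f using Finsupp.induction_linear with
  | zero => exact Submodule.zero_mem _
  | add f g hf hg => exact Submodule.add_mem _ hf hg
  | single b p =>
    induction p using MvPolynomial.induction_on' with
    | monomial m c =>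
      refine Submodule.mem_iSup_of_mem (Finsupp.weight w m + deg b) ?_
      intro b'
      by_cases h : b = b'
      · subst h
        rw [Finsupp.single_eq_same, mem_weightedHomogeneousSubmodule]
        exact isWeightedHomogeneous_monomial _ _ _ (by ring)
      · rw [Finsupp.single_eq_of_ne' h]
        exact Submodule.zero_mem _
    | add p q hp hq =>
      rw [Finsupp.single_add]
      exact Submodule.add_mem _ hp hq

theorem smul_mem_freeDegree {ι : Type*} {deg : ι → ℤ} {a e : ℤ} {p : MvPolynomial σ k}
    {f : ι →₀ MvPolynomial σ k} (hp : p ∈ weightedHomogeneousSubmodule k w a)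
    (hf : f ∈ freeDegree k w deg e) : p • f ∈ freeDegree k w deg (a + e) := by
  intro b
  have := IsWeightedHomogeneous.mul ((mem_weightedHomogeneousSubmodule ..).1 hp)
    ((mem_weightedHomogeneousSubmodule ..).1 (hf b))
  rw [mem_weightedHomogeneousSubmodule, add_sub_assoc]
  exact this

theorem map_mem_freeDegree {ι κ : Type*} {deg : ι → ℤ} {deg' : κ → ℤ}
    (φ : (ι →₀ MvPolynomial σ k) →ₗ[MvPolynomial σ k] (κ →₀ MvPolynomial σ k))
    (hφ : ∀ b, φ (Finsupp.single b 1) ∈ freeDegree k w deg' (deg b)) {e : ℤ}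
    {f : ι →₀ MvPolynomial σ k} (hf : f ∈ freeDegree k w deg e) :
    φ f ∈ freeDegree k w deg' e := by
  have h : f = f.sum fun b p => p • Finsupp.single b 1 := by
    simp
  rw [h, map_finsuppSum]
  refine Submodule.sum_mem _ fun b _ => ?_
  change φ (f b • Finsupp.single b 1) ∈ _
  rw [map_smul]
  have := smul_mem_freeDegree (hf b) (hφ b)
  rwa [sub_add_cancel] at this

theorem eq_zero_of_sum_freeDegree {ι : Type*} {deg : ι → ℤ} (E : Finset ℤ)
    (g : ℤ → ι →₀ MvPolynomial σ k) (hg : ∀ e, g e ∈ freeDegree k w deg e)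
    (h : ∑ e ∈ E, g e = 0) : ∀ e ∈ E, g e = 0 := by
  classical
  intro e he
  ext1 b
  have h1 : ∑ e' ∈ E, weightedHomogeneousComponent w (e - deg b) (g e' b) = 0 := by
    rw [← map_sum, ← Finsupp.finsetSum_apply, h]
    simp
  rw [Finset.sum_eq_single e] at h1
  · rw [weightedHomogeneousComponent_of_mem (hg e b), if_pos rfl] at h1
    simpa using h1
  · intro e' _ hne
    rw [weightedHomogeneousComponent_of_mem (hg e' b), if_neg]
    intro h2
    exact hne (by linarith)
  · exact fun h => absurd he h

/-- The kernel of a homogeneous map is generated by its homogeneous elements. -/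
theorem ker_le_span_freeDegree {ι κ : Type*} {deg : ι → ℤ} {deg' : κ → ℤ}
    (φ : (ι →₀ MvPolynomial σ k) →ₗ[MvPolynomial σ k] (κ →₀ MvPolynomial σ k))
    (hφ : ∀ b, φ (Finsupp.single b 1) ∈ freeDegree k w deg' (deg b)) :
    LinearMap.ker φ ≤ Submodule.span (MvPolynomial σ k)
      {f | f ∈ LinearMap.ker φ ∧ ∃ e, f ∈ freeDegree k w deg e} := by
  intro f hf
  have hf' : f ∈ ⨆ e, freeDegree k w deg e := by
    rw [iSup_freeDegree]; trivial
  obtain ⟨g, hg, rfl⟩ := (Submodule.mem_iSup_iff_exists_finsupp _ _).1 hf'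
  rw [Finsupp.sum]
  have h0 : ∑ e ∈ g.support, φ (g e) = 0 := by
    rw [← map_sum]
    exact hf
  have h1 := eq_zero_of_sum_freeDegree g.support (fun e => φ (g e))
    (fun e => map_mem_freeDegree φ hφ (hg e)) h0
  exact Submodule.sum_mem _ fun e he => Submodule.subset_span ⟨h1 e he, e, hg e⟩

/-- A graded free module with a submodule generated by homogeneous elements. -/
structure GradedStage (k : Type u) [Field k] {σ : Type v} (w : σ → ℤ) where
  ι : Type (max u v)
  deg : ι → ℤ
  K : Submodule (MvPolynomial σ k) (ι →₀ MvPolynomial σ k)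
  le_span : K ≤ Submodule.span (MvPolynomial σ k) {f | f ∈ K ∧ ∃ e, f ∈ freeDegree k w deg e}

/-- The homogeneous elements of the submodule of a stage. -/
def GradedStage.Idx (A : GradedStage k w) : Type (max u v) :=
  Σ e : ℤ, {f : A.ι →₀ MvPolynomial σ k // f ∈ A.K ∧ f ∈ freeDegree k w A.deg e}

/-- The graded free cover of the submodule of a stage. -/
def GradedStage.cover (A : GradedStage k w) :
    (A.Idx →₀ MvPolynomial σ k) →ₗ[MvPolynomial σ k] (A.ι →₀ MvPolynomial σ k) :=
  Finsupp.linearCombination (MvPolynomial σ k) (fun b : A.Idx => b.2.1)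

theorem GradedStage.cover_degree (A : GradedStage k w) (b : A.Idx) :
    A.cover (Finsupp.single b 1) ∈ freeDegree k w A.deg b.1 := by
  rw [GradedStage.cover, Finsupp.linearCombination_single, one_smul]
  exact b.2.2.2

theorem GradedStage.range_cover (A : GradedStage k w) : LinearMap.range A.cover = A.K := by
  rw [GradedStage.cover, Finsupp.range_linearCombination]
  refine le_antisymm (Submodule.span_le.2 ?_) (A.le_span.trans (Submodule.span_mono ?_))
  · rintro _ ⟨b, rfl⟩
    exact b.2.2.1
  · rintro f ⟨hf, e, he⟩
    exact ⟨⟨e, f, hf, he⟩, rfl⟩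

theorem GradedStage.mem_range_cover (A : GradedStage k w) (y : A.ι →₀ MvPolynomial σ k) :
    y ∈ Set.range A.cover ↔ y ∈ A.K := by
  rw [← A.range_cover]
  rfl

/-- The next stage: the kernel of the cover. -/
def GradedStage.next (A : GradedStage k w) : GradedStage k w where
  ι := A.Idx
  deg b := b.1
  K := LinearMap.ker A.cover
  le_span := ker_le_span_freeDegree A.cover A.cover_degree

/-- The augmentation `T → k`. -/
def augmentation (k : Type u) [Field k] (σ : Type v) :
    (PUnit.{max u v + 1} →₀ MvPolynomial σ k) →ₗ[MvPolynomial σ k] ResidueModule k σ :=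
  (Submodule.mkQ _).comp (Finsupp.lapply PUnit.unit)

theorem augmentation_eq_zero_iff (f : PUnit.{max u v + 1} →₀ MvPolynomial σ k) :
    augmentation k σ f = 0 ↔
      f PUnit.unit ∈ Ideal.span (Set.range (X : σ → MvPolynomial σ k)) :=
  Submodule.Quotient.mk_eq_zero _

/-- The kernel of the augmentation, as a stage. -/
def initialStage (k : Type u) [Field k] {σ : Type v} (w : σ → ℤ) : GradedStage k w where
  ι := PUnit
  deg _ := 0
  K := LinearMap.ker (augmentation k σ)
  le_span := by
    intro f hf
    have h1 : f PUnit.unit ∈ Ideal.span (Set.range (X : σ → MvPolynomial σ k)) :=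
      (augmentation_eq_zero_iff f).1 hf
    have h2 : f = Finsupp.lsingle (R := MvPolynomial σ k) PUnit.unit (f PUnit.unit) := by
      ext1; simp
    rw [h2]
    have h3 := Submodule.mem_map_of_mem
      (f := Finsupp.lsingle (R := MvPolynomial σ k) (PUnit.unit : PUnit.{max u v + 1})) h1
    refine (?_ : Submodule.map _ (Submodule.span _ _) ≤ _) h3
    rw [Submodule.map_span, Submodule.span_le]
    rintro _ ⟨_, ⟨j, rfl⟩, rfl⟩
    refine Submodule.subset_span ⟨?_, w j, ?_⟩
    · have : (X j : MvPolynomial σ k) ∈ Ideal.span (Set.range (X : σ → MvPolynomial σ k)) :=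
        Ideal.subset_span ⟨j, rfl⟩
      exact (augmentation_eq_zero_iff _).2 (by simpa using this)
    · intro b
      simpa using isWeightedHomogeneous_X k w j

/-- The sequence of stages. -/
def stage (k : Type u) [Field k] {σ : Type v} (w : σ → ℤ) : ℕ → GradedStage k w
  | 0 => initialStage k w
  | n + 1 => (stage k w n).next

theorem nonempty_gradedFreeResolution (k : Type u) [Field k] {σ : Type v} (w : σ → ℤ) :
    Nonempty (GradedFreeResolution k w (ResidueModule k σ) (residueDegree k w)) :=
  ⟨{ ι := fun n => (stage k w n).ι
     deg := fun n => (stage k w n).deg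
     d := fun n => (stage k w n).cover
     ε := augmentation k σ
     d_degree := fun n b => (stage k w n).cover_degree b
     ε_degree := fun b =>
      ⟨1, isWeightedHomogeneous_one k w, by
        change _ = Submodule.mkQ _ ((Finsupp.single b (1 : MvPolynomial σ k)) b)
        rw [Finsupp.single_eq_same]; rfl⟩
     ε_surjective := by
      intro y
      obtain ⟨p, rfl⟩ := Submodule.mkQ_surjective _ y
      exact ⟨Finsupp.single PUnit.unit p, by
        change Submodule.mkQ _ ((Finsupp.single PUnit.unit p) PUnit.unit) = _
        rw [Finsupp.single_eq_same]⟩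
     exact_ε := fun y => ((stage k w 0).mem_range_cover y).symm
     exact_d := fun n => fun y => ((stage k w (n + 1)).mem_range_cover y).symm }⟩

end Existence

/-! ### Graded Tor -/

section Tor

variable {k : Type u} [Field k] {σ : Type v} {w : σ → ℤ}
  {N : Type*} [AddCommGroup N] [Module (MvPolynomial σ k) N] [Module k N]
  {𝓝 : ℤ → Submodule k N}
  (F : GradedFreeResolution k w N 𝓝)
  (M : Type*) [AddCommGroup M] [Module (MvPolynomial σ k) M] [Module k M]
  [IsScalarTower k (MvPolynomial σ k) M]
  (𝓜 : ℤ → Submodule k M)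

/-- The degree `s` part of `M ⊗_T F_i`, spanned by the `m ⊗ f` with `m`, `f` homogeneous and
`deg m + deg f = s`. -/
def GradedFreeResolution.tensorDegree (i : ℕ) (s : ℤ) :
    Submodule k (M ⊗[MvPolynomial σ k] (F.ι i →₀ MvPolynomial σ k)) :=
  Submodule.span k
    {x | ∃ a b : ℤ, a + b = s ∧ ∃ m ∈ 𝓜 a, ∃ f ∈ freeDegree k w (F.deg i) b, x = m ⊗ₜ f}

/-- The differential `M ⊗_T F_{i+1} → M ⊗_T F_i`, as a `k`-linear map. -/
def GradedFreeResolution.tensorD (i : ℕ) :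
    (M ⊗[MvPolynomial σ k] (F.ι (i + 1) →₀ MvPolynomial σ k)) →ₗ[k]
      (M ⊗[MvPolynomial σ k] (F.ι i →₀ MvPolynomial σ k)) :=
  (LinearMap.lTensor M (F.d i)).restrictScalars k

/-- The `i`-cycles of `M ⊗_T F` of degree `s`. -/
def GradedFreeResolution.cycles : (i : ℕ) → (s : ℤ) →
    Submodule k (M ⊗[MvPolynomial σ k] (F.ι i →₀ MvPolynomial σ k))
  | 0, s => F.tensorDegree M 𝓜 0 s
  | i + 1, s => F.tensorDegree M 𝓜 (i + 1) s ⊓ LinearMap.ker (F.tensorD M i)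

/-- The `i`-boundaries of `M ⊗_T F` of degree `s`. -/
def GradedFreeResolution.boundaries (i : ℕ) (s : ℤ) :
    Submodule k (M ⊗[MvPolynomial σ k] (F.ι i →₀ MvPolynomial σ k)) :=
  (F.tensorDegree M 𝓜 (i + 1) s).map (F.tensorD M i)

/-- `Tor_i^T(M, N)_s = H_i(M ⊗_T F)_s`, where `F` is a graded free resolution of `N`. -/
abbrev GradedFreeResolution.gradedTor (i : ℕ) (s : ℤ) : Type _ :=
  F.cycles M 𝓜 i s ⧸ (F.boundaries M 𝓜 i s).comap (F.cycles M 𝓜 i s).subtype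

end Tor

/-! ### Betti numbers of a semigroup ring -/

/-- The polynomial ring `T` on one variable for each minimal generator of `S`. -/
abbrev GenPoly (k : Type u) [Field k] (S : AddSubmonoid ℕ) : Type u :=
  MvPolynomial (minGens S) k

/-- The weights: the variable of the generator `g` has degree `g`. -/
def genWeight (S : AddSubmonoid ℕ) : minGens S → ℤ := fun g => ((g : ℕ) : ℤ)

/-- The semigroup ring `k[S]`, with `k`-basis `t^s`, `s ∈ S`. -/
abbrev SemigroupRing (k : Type u) [Field k] (S : AddSubmonoid ℕ) : Type u :=
  AddMonoidAlgebra k S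

/-- `k[S]` is a `T`-algebra: the variable of the generator `g` acts as `t^g`. -/
instance SemigroupRing.genAlgebra (k : Type u) [Field k] (S : AddSubmonoid ℕ) :
    Algebra (GenPoly k S) (SemigroupRing k S) :=
  (MvPolynomial.aeval (R := k)
    fun g : minGens S => (AddMonoidAlgebra.single ⟨g, g.2.1⟩ 1 : SemigroupRing k S)).toAlgebra

instance SemigroupRing.genScalarTower (k : Type u) [Field k] (S : AddSubmonoid ℕ) :
    IsScalarTower k (GenPoly k S) (SemigroupRing k S) :=
  IsScalarTower.of_algebraMap_eq fun c => (AlgHom.commutes (MvPolynomial.aeval (R := k)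
    fun g : minGens S => (AddMonoidAlgebra.single ⟨g, g.2.1⟩ 1 : SemigroupRing k S)) c).symm

/-- The grading of `k[S]`: `t^s` has degree `s`. -/
def semigroupRingDegree (k : Type u) [Field k] (S : AddSubmonoid ℕ) (e : ℤ) :
    Submodule k (SemigroupRing k S) :=
  AddMonoidAlgebra.gradeBy k (fun s : S => ((s : ℕ) : ℤ)) e

/-- The graded Betti number `β_{i,s}(S) = dim_k Tor_i^T(k[S], k)_s`. As usual, `Tor` is computed
from a graded free resolution of `k`, and does not depend on which one is taken. -/
def gradedBetti (k : Type u) [Field k] (S : AddSubmonoid ℕ) (i : ℕ) (s : ℤ) : ℕ :=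
  Module.finrank k
    ((Classical.choice (nonempty_gradedFreeResolution k (genWeight S))).gradedTor
      (SemigroupRing k S) (semigroupRingDegree k S) i s)

end

/-! Write m for the multiplicity n₁. Tor may be computed from the Koszul resolution of k, because
two graded free resolutions are linked by chain maps unique up to homotopy. Every graded piece of
k[S] has dimension at most one and the variables act as shifts. Hence the degree s strand of the
Koszul complex of k[S] is a complex of scalars on the sets I of generators with s - ∑ I in S, the
squarefree divisor complex (`gradedBetti_eq_finrank`).

The Arf condition at m says that a + b - m lies in S for all nonzero a, b in S. So the Apéry set {u
∈ S : u - m ∉ S} consists of 0 and the generators other than m. Contracting the divisor complex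
along m pairs J with J ∪ {m} and leaves only the sets J without m for which s - ∑ J is in the Apéry
set: "zero cells", where this difference is 0, and "generator cells", where it is a generator other
than m. This is the Koszul complex of k[S]/(t^m), whose maximal ideal has square zero. Its
differential therefore only sends zero cells with i + 1 elements to generator cells with i elements,
and it is injective on zero cells other than the empty set. Outside (i, s) = (0, 0) this gives
β_{i,s} + #(zero cells of size i + 1) = #(generator cells of size i)
(`IsMaximalEmbedding.finrank_homology_add`).

The blowup is S(m), again an Arf semigroup. When it has the same multiplicity, its Apéry set is
obtained from that of S by lowering each nonzero element by m, so the generators other than m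
correspond with a shift by m. Both kinds of cells involve exactly i + 1 such generators, so both
counts agree after raising s by (i + 1)m. The excluded pairs are those where one of the two
semigroups is evaluated at (0, 0). -/

noncomputable section

/-! ### Independence of graded Tor from the resolution of the residue field -/

section Comparison

variable {k : Type u} [Field k] {σ : Type v} {w : σ → ℤ}

/-- A linear map of graded free modules that is homogeneous of degree `0`. -/
def IsDegreeZero (w : σ → ℤ) {ι κ : Type*} (deg : ι → ℤ) (deg' : κ → ℤ)
    (φ : (ι →₀ MvPolynomial σ k) →ₗ[MvPolynomial σ k] (κ →₀ MvPolynomial σ k)) : Prop :=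
  ∀ b, φ (Finsupp.single b 1) ∈ freeDegree k w deg' (deg b)

theorem IsDegreeZero.comp {ι κ μ : Type*} {deg : ι → ℤ} {deg' : κ → ℤ} {deg'' : μ → ℤ}
    {ψ : (κ →₀ MvPolynomial σ k) →ₗ[MvPolynomial σ k] (μ →₀ MvPolynomial σ k)}
    {φ : (ι →₀ MvPolynomial σ k) →ₗ[MvPolynomial σ k] (κ →₀ MvPolynomial σ k)}
    (hψ : IsDegreeZero w deg' deg'' ψ) (hφ : IsDegreeZero w deg deg' φ) :
    IsDegreeZero w deg deg'' (ψ ∘ₗ φ) :=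
  fun b => map_mem_freeDegree ψ hψ (hφ b)

theorem IsDegreeZero.sub {ι κ : Type*} {deg : ι → ℤ} {deg' : κ → ℤ}
    {φ ψ : (ι →₀ MvPolynomial σ k) →ₗ[MvPolynomial σ k] (κ →₀ MvPolynomial σ k)}
    (hφ : IsDegreeZero w deg deg' φ) (hψ : IsDegreeZero w deg deg' ψ) :
    IsDegreeZero w deg deg' (φ - ψ) :=
  fun b => Submodule.sub_mem _ (hφ b) (hψ b)

theorem isDegreeZero_id {ι : Type*} {deg : ι → ℤ} :
    IsDegreeZero w deg deg (LinearMap.id : (ι →₀ MvPolynomial σ k) →ₗ[MvPolynomial σ k] _) := by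
  classical
  intro b b'
  by_cases h : b = b'
  · subst h
    simpa using isWeightedHomogeneous_one k w
  · simp [Finsupp.single_eq_of_ne' h]

/-- The degree `e` component of an arbitrary preimage already works, since `d` preserves degrees and
homogeneous components are independent. -/
theorem exists_homogeneous_preimage {ι κ : Type*} {deg : ι → ℤ} {deg' : κ → ℤ}
    {d : (ι →₀ MvPolynomial σ k) →ₗ[MvPolynomial σ k] (κ →₀ MvPolynomial σ k)}
    (hd : IsDegreeZero w deg deg' d) {e : ℤ} {y : κ →₀ MvPolynomial σ k}
    (hy : y ∈ freeDegree k w deg' e) (h : y ∈ Set.range d) :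
    ∃ x ∈ freeDegree k w deg e, d x = y := by
  classical
  obtain ⟨x, rfl⟩ := h
  have hx : x ∈ ⨆ e, freeDegree k w deg e := by rw [iSup_freeDegree]; trivial
  obtain ⟨g, hg, rfl⟩ := (Submodule.mem_iSup_iff_exists_finsupp _ _).1 hx
  refine ⟨g e, hg e, ?_⟩
  set y := d (g.sum fun _ x => x) with hydef
  -- Subtracting `y` in degree `e` makes the homogeneous images sum to zero. Inserting `e` covers
  -- the case where the preimage has no component of that degree.
  have key := eq_zero_of_sum_freeDegree (insert e g.support)
    (fun a => d (g a) - if a = e then y else 0) (deg := deg') (w := w) ?_ ?_ e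
    (Finset.mem_insert_self _ _)
  · simpa [sub_eq_zero] using key
  · intro a
    refine Submodule.sub_mem _ (map_mem_freeDegree d hd (hg a)) ?_
    split_ifs with ha
    · exact ha ▸ hy
    · exact Submodule.zero_mem _
  · rw [Finset.sum_sub_distrib, Finset.sum_ite_eq', if_pos (Finset.mem_insert_self _ _),
      sub_eq_zero, hydef, Finsupp.sum, map_sum]
    refine (Finset.sum_subset (Finset.subset_insert _ _) fun a _ ha => ?_).symm
    rw [Finsupp.notMem_support_iff.1 ha, map_zero]

/-- Graded lifting: a degree zero map with values in the image of a degree zero map lifts. -/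
theorem exists_isDegreeZero_lift {ι κ μ : Type*} {deg : ι → ℤ} {deg' : κ → ℤ} {deg'' : μ → ℤ}
    {d : (κ →₀ MvPolynomial σ k) →ₗ[MvPolynomial σ k] (μ →₀ MvPolynomial σ k)}
    (hd : IsDegreeZero w deg' deg'' d)
    {φ : (ι →₀ MvPolynomial σ k) →ₗ[MvPolynomial σ k] (μ →₀ MvPolynomial σ k)}
    (hφ : IsDegreeZero w deg deg'' φ) (h : ∀ x, φ x ∈ Set.range d) :
    ∃ ψ, IsDegreeZero w deg deg' ψ ∧ d ∘ₗ ψ = φ := by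
  choose x hx hdx using fun b => exists_homogeneous_preimage hd (hφ b) (h (Finsupp.single b 1))
  refine ⟨Finsupp.linearCombination _ x, fun b => ?_, ?_⟩
  · simpa using hx b
  · refine Finsupp.lhom_ext' fun b => LinearMap.ext_ring ?_
    simpa using hdx b

/-- A monomial of nonzero weight is not 1, hence is divisible by a variable. No positivity of the
weights is needed. -/
theorem residueDegree_eq_bot {e : ℤ} (he : e ≠ 0) : residueDegree k w e = ⊥ := by
  rw [eq_bot_iff]
  rintro _ ⟨p, hp, rfl⟩
  refine Ideal.Quotient.eq_zero_iff_mem.2 ?_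
  rw [← Set.image_univ, mem_ideal_span_X_image]
  intro n hn
  by_contra! hcon
  have h0 : n = 0 := by
    ext j
    exact hcon j trivial
  have := hp (mem_support_iff.1 hn)
  rw [h0, map_zero] at this
  exact he this.symm

section

variable (F G : GradedFreeResolution k w (ResidueModule k σ) (residueDegree k w))

theorem GradedFreeResolution.ε_mem {e : ℤ} {f : F.ι 0 →₀ MvPolynomial σ k}
    (hf : f ∈ freeDegree k w (F.deg 0) e) : F.ε f ∈ residueDegree k w e := by
  have h : f = f.sum fun b p => p • Finsupp.single b 1 := by simp
  rw [h, map_finsuppSum]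
  refine Submodule.sum_mem _ fun b _ => ?_
  change F.ε (f b • Finsupp.single b 1) ∈ _
  rw [map_smul]
  obtain ⟨p, hp, hpb⟩ := F.ε_degree b
  refine ⟨f b * p, ?_, ?_⟩
  · have := IsWeightedHomogeneous.mul ((mem_weightedHomogeneousSubmodule ..).1 (hf b))
      ((mem_weightedHomogeneousSubmodule ..).1 hp)
    rwa [sub_add_cancel] at this
  · rw [← hpb]
    rfl

/-- The residue field lives in degree 0. Basis elements of other degrees map to zero and are lifted
by zero; for degree 0 the degree 0 component of any preimage serves. -/
theorem exists_ε_lift : ∃ φ, IsDegreeZero w (F.deg 0) (G.deg 0) φ ∧ G.ε ∘ₗ φ = F.ε := by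
  have h : ∀ b, ∃ x ∈ freeDegree k w (G.deg 0) (F.deg 0 b), G.ε x = F.ε (Finsupp.single b 1) := by
    intro b
    by_cases hb : F.deg 0 b = 0
    · obtain ⟨x, hx⟩ := G.ε_surjective (F.ε (Finsupp.single b 1))
      have hx' : x ∈ ⨆ e, freeDegree k w (G.deg 0) e := by rw [iSup_freeDegree]; trivial
      obtain ⟨g, hg, rfl⟩ := (Submodule.mem_iSup_iff_exists_finsupp _ _).1 hx'
      refine ⟨g 0, hb ▸ hg 0, ?_⟩
      rw [← hx, Finsupp.sum, map_sum, Finset.sum_eq_single 0]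
      · intro e _ he
        have := G.ε_mem (hg e)
        rwa [residueDegree_eq_bot he, Submodule.mem_bot] at this
      · intro h0
        rw [Finsupp.notMem_support_iff.1 h0, map_zero]
    · refine ⟨0, Submodule.zero_mem _, ?_⟩
      have := F.ε_degree b
      rw [residueDegree_eq_bot hb, Submodule.mem_bot] at this
      rw [this, map_zero]
  choose x hx hε using h
  refine ⟨Finsupp.linearCombination _ x, fun b => ?_, ?_⟩
  · simpa using hx b
  · refine Finsupp.lhom_ext' fun b => LinearMap.ext_ring ?_
    simpa using hε b

theorem GradedFreeResolution.d_comp_d (n : ℕ) : F.d n ∘ₗ F.d (n + 1) = 0 :=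
  (F.exact_d n).linearMap_comp_eq_zero

/-- A degree zero chain map between graded free resolutions. -/
structure GradedChainMap where
  f : ∀ n, (F.ι n →₀ MvPolynomial σ k) →ₗ[MvPolynomial σ k] (G.ι n →₀ MvPolynomial σ k)
  isDegreeZero : ∀ n, IsDegreeZero w (F.deg n) (G.deg n) (f n)
  comm : ∀ n, G.d n ∘ₗ f (n + 1) = f n ∘ₗ F.d n

/-- The identity of the residue field lifts to a degree zero chain map. -/
theorem exists_gradedChainMap : ∃ φ : GradedChainMap F G, G.ε ∘ₗ φ.f 0 = F.ε := by
  -- The recursion must carry the condition that makes the next lift exist: the composite with the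
  -- differential lands in the image of `G.d n`.
  let Good (n : ℕ)
      (f : (F.ι n →₀ MvPolynomial σ k) →ₗ[MvPolynomial σ k] (G.ι n →₀ MvPolynomial σ k)) : Prop :=
    IsDegreeZero w (F.deg n) (G.deg n) f ∧ ∀ x, f (F.d n x) ∈ Set.range (G.d n)
  have next : ∀ n (f : {f // Good n f}), ∃ g : {g // Good (n + 1) g},
      G.d n ∘ₗ g.1 = f.1 ∘ₗ F.d n := by
    rintro n ⟨f, hf, hr⟩
    obtain ⟨g, hg, hgf⟩ := exists_isDegreeZero_lift (G.d_degree n)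
      (hf.comp (F.d_degree n)) (φ := f ∘ₗ F.d n) hr
    refine ⟨⟨g, hg, fun x => ?_⟩, hgf⟩
    rw [← G.exact_d n, ← LinearMap.comp_apply, hgf, LinearMap.comp_apply,
      (F.exact_d n).apply_apply_eq_zero, map_zero]
  obtain ⟨f₀, hf₀, hε⟩ := exists_ε_lift F G
  have good₀ : Good 0 f₀ := ⟨hf₀, fun x => by
    rw [← G.exact_ε, ← LinearMap.comp_apply, hε, F.exact_ε.apply_apply_eq_zero]⟩
  choose g hg using next
  let f : ∀ n, {f // Good n f} := fun n => Nat.rec ⟨f₀, good₀⟩ g n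
  exact ⟨⟨fun n => (f n).1, fun n => (f n).2.1, fun n => hg n (f n)⟩, hε⟩

variable {F G}

/-- A degree zero chain map over the zero map is null-homotopic. -/
theorem GradedChainMap.exists_homotopy (φ : GradedChainMap F G) (h0 : G.ε ∘ₗ φ.f 0 = 0) :
    ∃ h : ∀ n, (F.ι n →₀ MvPolynomial σ k) →ₗ[MvPolynomial σ k] (G.ι (n + 1) →₀ MvPolynomial σ k),
      (∀ n, IsDegreeZero w (F.deg n) (G.deg (n + 1)) (h n)) ∧ φ.f 0 = G.d 0 ∘ₗ h 0 ∧
      ∀ n, φ.f (n + 1) = G.d (n + 1) ∘ₗ h (n + 1) + h n ∘ₗ F.d n := by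
  -- The carried identity says that `φ.f (n + 1) - h ∘ F.d n` takes values in cycles, so exactness
  -- lets it be lifted.
  let Good (n : ℕ) (h : (F.ι n →₀ MvPolynomial σ k) →ₗ[MvPolynomial σ k]
      (G.ι (n + 1) →₀ MvPolynomial σ k)) : Prop :=
    IsDegreeZero w (F.deg n) (G.deg (n + 1)) h ∧
      G.d n ∘ₗ φ.f (n + 1) = G.d n ∘ₗ h ∘ₗ F.d n
  have next : ∀ n (h : {h // Good n h}), ∃ h' : {h' // Good (n + 1) h'},
      φ.f (n + 1) = G.d (n + 1) ∘ₗ h'.1 + h.1 ∘ₗ F.d n := by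
    rintro n ⟨h, hh, hc⟩
    obtain ⟨h', hh', hc'⟩ := exists_isDegreeZero_lift (G.d_degree (n + 1))
      ((φ.isDegreeZero (n + 1)).sub (hh.comp (F.d_degree n))) (fun x => by
        rw [← G.exact_d n, ← LinearMap.comp_apply, LinearMap.comp_sub, hc]
        exact sub_self _)
    refine ⟨⟨h', hh', ?_⟩, by rw [hc']; exact (sub_add_cancel (φ.f (n + 1)) (h ∘ₗ F.d n)).symm⟩
    rw [φ.comm, ← LinearMap.comp_assoc, hc', LinearMap.sub_comp, LinearMap.comp_assoc,
      F.d_comp_d, LinearMap.comp_zero]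
    exact (sub_zero (φ.f (n + 1) ∘ₗ F.d (n + 1))).symm
  obtain ⟨h₀, hh₀, hc₀⟩ := exists_isDegreeZero_lift (G.d_degree 0) (φ.isDegreeZero 0)
    (fun x => by rw [← G.exact_ε, ← LinearMap.comp_apply, h0, LinearMap.zero_apply])
  have good₀ : Good 0 h₀ := ⟨hh₀, by rw [φ.comm, ← LinearMap.comp_assoc, hc₀]⟩
  choose g hg using next
  let h : ∀ n, {h // Good n h} := fun n => Nat.rec ⟨h₀, good₀⟩ g n
  exact ⟨fun n => (h n).1, fun n => (h n).2.1, hc₀.symm, fun n => hg n (h n)⟩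

/-- The composition of two degree zero chain maps. -/
def GradedChainMap.comp {H : GradedFreeResolution k w (ResidueModule k σ) (residueDegree k w)}
    (ψ : GradedChainMap G H) (φ : GradedChainMap F G) : GradedChainMap F H where
  f n := ψ.f n ∘ₗ φ.f n
  isDegreeZero n := (ψ.isDegreeZero n).comp (φ.isDegreeZero n)
  comm n := by
    rw [← LinearMap.comp_assoc, ψ.comm, LinearMap.comp_assoc, φ.comm, LinearMap.comp_assoc]

/-- The difference of a degree zero chain endomorphism and the identity. -/
def GradedChainMap.subId (φ : GradedChainMap F F) : GradedChainMap F F where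
  f n := φ.f n - LinearMap.id
  isDegreeZero n := (φ.isDegreeZero n).sub isDegreeZero_id
  comm n := by
    rw [LinearMap.comp_sub, LinearMap.sub_comp, φ.comm]
    rfl

variable (M : Type*) [AddCommGroup M] [Module (MvPolynomial σ k) M] [Module k M]
  [IsScalarTower k (MvPolynomial σ k) M] (𝓜 : ℤ → Submodule k M)

theorem lTensor_mem_tensorDegree {i j : ℕ}
    {φ : (F.ι i →₀ MvPolynomial σ k) →ₗ[MvPolynomial σ k] (G.ι j →₀ MvPolynomial σ k)}
    (hφ : IsDegreeZero w (F.deg i) (G.deg j) φ) {s : ℤ}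
    {x : M ⊗[MvPolynomial σ k] (F.ι i →₀ MvPolynomial σ k)} (hx : x ∈ F.tensorDegree M 𝓜 i s) :
    LinearMap.lTensor M φ x ∈ G.tensorDegree M 𝓜 j s := by
  have : F.tensorDegree M 𝓜 i s ≤
      (G.tensorDegree M 𝓜 j s).comap ((LinearMap.lTensor M φ).restrictScalars k) := by
    refine Submodule.span_le.2 ?_
    rintro _ ⟨a, b, hab, m, hm, f, hf, rfl⟩
    exact Submodule.subset_span ⟨a, b, hab, m, hm, φ f, map_mem_freeDegree φ hφ hf, rfl⟩
  exact this hx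

theorem GradedChainMap.tensorD_comm (φ : GradedChainMap F G) (i : ℕ)
    (x : M ⊗[MvPolynomial σ k] (F.ι (i + 1) →₀ MvPolynomial σ k)) :
    G.tensorD M i (LinearMap.lTensor M (φ.f (i + 1)) x) =
      LinearMap.lTensor M (φ.f i) (F.tensorD M i x) := by
  change LinearMap.lTensor M (G.d i) (LinearMap.lTensor M (φ.f (i + 1)) x) =
    LinearMap.lTensor M (φ.f i) (LinearMap.lTensor M (F.d i) x)
  rw [← LinearMap.lTensor_comp_apply, ← LinearMap.lTensor_comp_apply, φ.comm]

theorem GradedChainMap.mem_cycles (φ : GradedChainMap F G) {i : ℕ} {s : ℤ}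
    {x : M ⊗[MvPolynomial σ k] (F.ι i →₀ MvPolynomial σ k)} (hx : x ∈ F.cycles M 𝓜 i s) :
    LinearMap.lTensor M (φ.f i) x ∈ G.cycles M 𝓜 i s := by
  cases i with
  | zero => exact lTensor_mem_tensorDegree M 𝓜 (φ.isDegreeZero 0) hx
  | succ i =>
    refine ⟨lTensor_mem_tensorDegree M 𝓜 (φ.isDegreeZero _) hx.1, ?_⟩
    rw [SetLike.mem_coe, LinearMap.mem_ker, φ.tensorD_comm M, LinearMap.mem_ker.1 hx.2, map_zero]

theorem GradedChainMap.mem_boundaries (φ : GradedChainMap F G) {i : ℕ} {s : ℤ}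
    {x : M ⊗[MvPolynomial σ k] (F.ι i →₀ MvPolynomial σ k)} (hx : x ∈ F.boundaries M 𝓜 i s) :
    LinearMap.lTensor M (φ.f i) x ∈ G.boundaries M 𝓜 i s := by
  obtain ⟨y, hy, rfl⟩ := hx
  exact ⟨_, lTensor_mem_tensorDegree M 𝓜 (φ.isDegreeZero _) hy, φ.tensorD_comm M i y⟩

/-- `φ` minus the identity covers the zero map, so it is null-homotopic, and the homotopy survives
tensoring with `M`. -/
theorem GradedChainMap.sub_mem_boundaries (φ : GradedChainMap F F) (hφ : F.ε ∘ₗ φ.f 0 = F.ε)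
    {i : ℕ} {s : ℤ} {x : M ⊗[MvPolynomial σ k] (F.ι i →₀ MvPolynomial σ k)}
    (hx : x ∈ F.cycles M 𝓜 i s) :
    LinearMap.lTensor M (φ.f i) x - x ∈ F.boundaries M 𝓜 i s := by
  obtain ⟨h, hdeg, h0, hs⟩ := φ.subId.exists_homotopy
    (by change F.ε ∘ₗ (φ.f 0 - LinearMap.id) = 0; rw [LinearMap.comp_sub, hφ]; exact sub_self _)
  have key : LinearMap.lTensor M (φ.f i) x - x = LinearMap.lTensor M (φ.subId.f i) x := by
    change _ = LinearMap.lTensor M (φ.f i - LinearMap.id) x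
    rw [LinearMap.lTensor_sub, LinearMap.lTensor_id]
    rfl
  rw [key]
  cases i with
  | zero =>
    refine ⟨_, lTensor_mem_tensorDegree M 𝓜 (hdeg 0) hx, ?_⟩
    rw [h0, LinearMap.lTensor_comp]
    rfl
  | succ i =>
    refine ⟨_, lTensor_mem_tensorDegree M 𝓜 (hdeg _) hx.1, ?_⟩
    have hx2 : LinearMap.lTensor M (F.d i) x = 0 := hx.2
    rw [hs, LinearMap.lTensor_add, LinearMap.lTensor_comp, LinearMap.lTensor_comp,
      LinearMap.add_apply, LinearMap.comp_apply, LinearMap.comp_apply, hx2, map_zero, add_zero]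
    rfl

/-- The map induced on graded Tor by a degree zero chain map. -/
def GradedChainMap.mapTor (φ : GradedChainMap F G) (i : ℕ) (s : ℤ) :
    F.gradedTor M 𝓜 i s →ₗ[k] G.gradedTor M 𝓜 i s :=
  Submodule.mapQ _ _
    (((LinearMap.lTensor M (φ.f i)).restrictScalars k).restrict
      (fun _ hx => φ.mem_cycles M 𝓜 hx))
    (fun _ hx => φ.mem_boundaries M 𝓜 hx)

theorem GradedChainMap.mapTor_mapTor (ψ : GradedChainMap G F) (φ : GradedChainMap F G)
    (h : F.ε ∘ₗ ψ.f 0 ∘ₗ φ.f 0 = F.ε) (i : ℕ) (s : ℤ) (x : F.gradedTor M 𝓜 i s) :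
    ψ.mapTor M 𝓜 i s (φ.mapTor M 𝓜 i s x) = x := by
  obtain ⟨x, rfl⟩ := Submodule.mkQ_surjective _ x
  refine (Submodule.Quotient.eq _).2 ?_
  have := (ψ.comp φ).sub_mem_boundaries M 𝓜 h x.2
  rw [Submodule.mem_comap]
  convert this using 1
  change LinearMap.lTensor M (ψ.f i) (LinearMap.lTensor M (φ.f i) x.1) - x.1 =
    LinearMap.lTensor M (ψ.f i ∘ₗ φ.f i) x.1 - x.1
  rw [LinearMap.lTensor_comp_apply]

variable (F G) in
/-- Graded Tor does not depend on the resolution. -/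
theorem nonempty_gradedTor_equiv (i : ℕ) (s : ℤ) :
    Nonempty (F.gradedTor M 𝓜 i s ≃ₗ[k] G.gradedTor M 𝓜 i s) := by
  obtain ⟨φ, hφ⟩ := exists_gradedChainMap F G
  obtain ⟨ψ, hψ⟩ := exists_gradedChainMap G F
  exact ⟨LinearEquiv.ofLinearMap (φ.mapTor M 𝓜 i s) (ψ.mapTor M 𝓜 i s)
    (LinearMap.ext fun x => GradedChainMap.mapTor_mapTor M 𝓜 φ ψ
      (by rw [← LinearMap.comp_assoc, hφ, hψ]) i s x)
    (LinearMap.ext fun x => GradedChainMap.mapTor_mapTor M 𝓜 ψ φ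
      (by rw [← LinearMap.comp_assoc, hψ, hφ]) i s x)⟩

end

end Comparison

/-! ### The Koszul differential -/

section Koszul

variable {σ : Type v} [LinearOrder σ]

/-- The sign with which `j` enters the set `J`. -/
def koszulSign (j : σ) (J : Finset σ) : ℤ := (-1) ^ (J.filter (· < j)).card

theorem koszulSign_mul_self (j : σ) (J : Finset σ) : koszulSign j J * koszulSign j J = 1 := by
  rw [koszulSign, ← mul_pow]
  simp

theorem koszulSign_insert {j l : σ} {J : Finset σ} (hl : l ∉ J) :
    koszulSign j (insert l J) = if l < j then -koszulSign j J else koszulSign j J := by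
  unfold koszulSign
  rw [Finset.filter_insert]
  split_ifs with h
  · rw [Finset.card_insert_of_notMem (by simp [hl]), pow_succ]
    ring
  · rfl

/-- Exactly one of `j < l` and `l < j` holds, so exactly one of the two second insertions changes
its sign. -/
theorem koszulSign_swap {j l : σ} {J : Finset σ} (hjl : j ≠ l) (hj : j ∉ J) (hl : l ∉ J) :
    koszulSign j J * koszulSign l (insert j J) = -(koszulSign l J * koszulSign j (insert l J)) := by
  rw [koszulSign_insert hj, koszulSign_insert hl]
  rcases lt_or_gt_of_ne hjl with h | h
  · rw [if_pos h, if_neg h.not_gt]; ring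
  · rw [if_neg h.not_gt, if_pos h]; ring

variable [Fintype σ] {R : Type*} [CommRing R] {M : Type*} [AddCommGroup M] [Module R M]

/-- The Koszul differential of the sequence `x` on families indexed by the subsets of `σ`. -/
def koszulD (x : σ → R) : (Finset σ → M) →ₗ[R] (Finset σ → M) where
  toFun c J := ∑ j ∈ Jᶜ, koszulSign j J • x j • c (insert j J)
  map_add' c c' := by
    ext J
    simp only [Pi.add_apply, smul_add, Finset.sum_add_distrib]
  map_smul' r c := by
    ext J
    simp only [Pi.smul_apply, RingHom.id_apply, Finset.smul_sum]
    refine Finset.sum_congr rfl fun j _ => ?_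
    rw [smul_comm r, smul_comm r]

theorem koszulD_apply (x : σ → R) (c : Finset σ → M) (J : Finset σ) :
    koszulD x c J = ∑ j ∈ Jᶜ, koszulSign j J • x j • c (insert j J) := rfl

theorem koszulD_koszulD (x : σ → R) (c : Finset σ → M) : koszulD x (koszulD x c) = 0 := by
  ext J
  simp only [koszulD_apply, Finset.smul_sum, Pi.zero_apply]
  rw [Finset.sum_sigma']
  have hterm : ∀ j l, j ∉ J → l ∉ insert j J →
      koszulSign j J • x j • koszulSign l (insert j J) • x l • c (insert l (insert j J)) +
      koszulSign l J • x l • koszulSign j (insert l J) • x j • c (insert j (insert l J)) = 0 := by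
    intro j l hj hl
    rw [Finset.mem_insert, not_or] at hl
    rw [smul_comm (x j) (koszulSign l (insert j J)), smul_comm (x l) (koszulSign j (insert l J)),
      smul_smul, smul_smul (koszulSign l J), koszulSign_swap (Ne.symm hl.1) hj hl.2,
      Finset.insert_comm, smul_comm (x j) (x l), neg_smul, neg_add_cancel]
  refine Finset.sum_involution (fun p _ => ⟨p.2, p.1⟩) ?_ ?_ ?_ ?_
  · rintro ⟨j, l⟩ h
    rw [Finset.mem_sigma, Finset.mem_compl, Finset.mem_compl] at h
    exact hterm j l h.1 h.2
  · rintro ⟨j, l⟩ h _ heq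
    rw [Finset.mem_sigma, Finset.mem_compl, Finset.mem_compl] at h
    have : l = j := congrArg Sigma.fst heq
    exact h.2 (this ▸ Finset.mem_insert_self _ _)
  · rintro ⟨j, l⟩ h
    simp only [Finset.mem_sigma, Finset.mem_compl, Finset.mem_insert, not_or] at h ⊢
    exact ⟨h.2.2, Ne.symm h.2.1, h.1⟩
  · rintro ⟨j, l⟩ _
    rfl

/-- The contraction of the Koszul complex along the variable `b`, for an operator `δ` on the
coefficients that divides by the `b`-th element. -/
def koszulContraction (b : σ) (δ : M →+ M) (c : Finset σ → M) : Finset σ → M :=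
  fun I => if b ∈ I then koszulSign b (I.erase b) • δ (c (I.erase b)) else 0

/-- Only a left inverse `δ` of `x b` commuting with the other `x j` is required. Division by a
variable gives exactness of the Koszul complex; `δ = id` with all `x j = 1` gives the contraction of
the divisor complex. -/
theorem koszul_homotopy {x : σ → R} {b : σ} {δ : M →+ M} (hb : ∀ m, δ (x b • m) = m)
    (hj : ∀ j ≠ b, ∀ m, δ (x j • m) = x j • δ m) (c : Finset σ → M) (J : Finset σ) :
    koszulD x (koszulContraction b δ c) J + koszulContraction b δ (koszulD x c) J =
      if b ∈ J then c J else x b • δ (c J) := by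
  by_cases h : b ∈ J
  · obtain ⟨J, hbJ, rfl⟩ : ∃ J', b ∉ J' ∧ J = insert b J' :=
      ⟨J.erase b, Finset.notMem_erase _ _, (Finset.insert_erase h).symm⟩
    have hc : Jᶜ = insert b (insert b J)ᶜ := by
      ext j
      by_cases hjb : j = b <;> simp [hjb, hbJ]
    rw [if_pos h, koszulContraction, if_pos h, Finset.erase_insert hbJ, koszulD_apply,
      koszulD_apply, hc, Finset.sum_insert (by simp), smul_comm (koszulSign b J) (x b), map_add,
      hb, smul_add, smul_smul, koszulSign_mul_self, one_smul, map_sum, Finset.smul_sum,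
      add_left_comm, ← Finset.sum_add_distrib, Finset.sum_eq_zero, add_zero]
    intro j hjJ
    rw [Finset.mem_compl, Finset.mem_insert, not_or] at hjJ
    rw [koszulContraction, if_pos (by simp), Finset.insert_comm, Finset.erase_insert
      (by simp [hbJ, Ne.symm hjJ.1]), map_zsmul, hj j hjJ.1,
      smul_comm (x j) (koszulSign b (insert j J)), smul_smul, smul_smul (koszulSign b J)]
    have := koszulSign_swap hjJ.1 hjJ.2 hbJ
    -- This is the swap rule multiplied by `koszulSign j J * koszulSign j (insert b J)`, all squares
    -- of signs being 1.
    have h2 : koszulSign j (insert b J) * koszulSign b (insert j J) =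
        -(koszulSign b J * koszulSign j J) := by
      have e1 := koszulSign_mul_self b J
      have e2 := koszulSign_mul_self j J
      linear_combination (-koszulSign j (insert b J) * koszulSign b (insert j J)) * e2 +
        koszulSign j J * koszulSign j (insert b J) * this +
        (-koszulSign j J * koszulSign b J) * koszulSign_mul_self j (insert b J)
    rw [h2, neg_smul, neg_add_cancel]
  · rw [if_neg h, koszulContraction, if_neg h, add_zero, koszulD_apply, Finset.sum_eq_single b]
    · rw [koszulContraction, if_pos (Finset.mem_insert_self _ _), Finset.erase_insert h,
        smul_comm (x b) (koszulSign b J), smul_smul, koszulSign_mul_self, one_smul]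
    · intro j _ hjb
      rw [koszulContraction, if_neg, smul_zero, smul_zero]
      simp [Ne.symm hjb, h]
    · intro hb
      simp [h] at hb

end Koszul

/-! ### The Koszul resolution of the residue field -/

section DivX

variable {σ : Type v} {k : Type u} [Field k]

/-- Division by a variable. -/
def divX (b : σ) : MvPolynomial σ k →+ MvPolynomial σ k where
  toFun p := p.divMonomial (Finsupp.single b 1)
  map_zero' := zero_divMonomial _
  map_add' p q := add_divMonomial p q _

theorem divX_X_mul_self (b : σ) (p : MvPolynomial σ k) : divX b ((X b : MvPolynomial σ k) • p) = p :=
  X_mul_divMonomial b p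

theorem divX_X_mul {b j : σ} (h : j ≠ b) (p : MvPolynomial σ k) :
    divX b ((X j : MvPolynomial σ k) • p) = (X j : MvPolynomial σ k) • divX b p := by
  classical
  ext m
  change coeff m ((X j * p).divMonomial _) = coeff m (X j * p.divMonomial _)
  rw [coeff_divMonomial, coeff_X_mul', coeff_X_mul']
  have hs : j ∈ (Finsupp.single b 1 + m).support ↔ j ∈ m.support := by
    simp [Finsupp.single_eq_of_ne h]
  by_cases hj : j ∈ m.support
  · rw [if_pos hj, if_pos (hs.2 hj), coeff_divMonomial]
    congr 1
    ext a
    have : m j ≠ 0 := Finsupp.mem_support_iff.1 hj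
    by_cases ha : a = j
    · subst ha
      simp [Finsupp.single_eq_of_ne h]
    · simp [Finsupp.single_eq_of_ne ha]
  · rw [if_neg hj, if_neg (mt hs.1 hj)]

end DivX

section KoszulResolution

/-- The subsets of `σ` with `n` elements. -/
abbrev KoszulIndex (σ : Type v) (n : ℕ) : Type (max u v) :=
  ULift.{u} {I : Finset σ // I.card = n}

variable {σ : Type v} {R : Type*} [CommRing R] {M : Type*} [AddCommGroup M] [Module R M]

/-- Extension by zero of a family indexed by the `n`-element subsets to all subsets. -/
def extendZero (R : Type*) [CommRing R] {M : Type*} [AddCommGroup M] [Module R M] (n : ℕ) :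
    (KoszulIndex.{u} σ n →₀ M) →ₗ[R] (Finset σ → M) where
  toFun f I := if h : I.card = n then f ⟨I, h⟩ else 0
  map_add' f g := by
    ext I
    by_cases h : I.card = n <;> simp [h]
  map_smul' r f := by
    ext I
    by_cases h : I.card = n <;> simp [h]

theorem extendZero_apply {n : ℕ} (f : KoszulIndex.{u} σ n →₀ M) (b : KoszulIndex.{u} σ n) :
    extendZero R n f b.down.1 = f b := by
  simp [extendZero, b.down.2]

theorem extendZero_of_card_ne {n : ℕ} (f : KoszulIndex.{u} σ n →₀ M) {I : Finset σ}
    (h : I.card ≠ n) : extendZero R n f I = 0 := by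
  simp [extendZero, h]

theorem extendZero_injective {n : ℕ} :
    Function.Injective (extendZero R n : (KoszulIndex.{u} σ n →₀ M) →ₗ[R] (Finset σ → M)) := by
  intro f g h
  ext b
  rw [← extendZero_apply (R := R) f, ← extendZero_apply (R := R) g, h]

theorem extendZero_single [DecidableEq σ] {n : ℕ} (b : KoszulIndex.{u} σ n) (m : M) :
    extendZero R n (Finsupp.single b m) = Pi.single b.down.1 m := by
  ext I
  by_cases h : I.card = n
  · have := extendZero_apply (R := R) (Finsupp.single b m) ⟨I, h⟩
    rw [show extendZero R n (Finsupp.single b m) I = _ from this]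
    by_cases hb : b = ⟨I, h⟩
    · subst hb
      simp
    · rw [Finsupp.single_eq_of_ne' hb, Pi.single_eq_of_ne]
      rintro rfl
      exact hb rfl
  · rw [extendZero_of_card_ne _ h, Pi.single_eq_of_ne]
    rintro rfl
    exact h b.down.2

variable [Fintype σ]

/-- Restriction of a family indexed by all subsets to the `n`-element subsets. -/
def restrictCard (R : Type*) [CommRing R] {M : Type*} [AddCommGroup M] [Module R M] (n : ℕ) :
    (Finset σ → M) →ₗ[R] (KoszulIndex.{u} σ n →₀ M) where
  toFun c := Finsupp.equivFunOnFinite.symm fun b => c b.down.1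
  map_add' c c' := by ext b; simp
  map_smul' r c := by ext b; simp

theorem restrictCard_apply {n : ℕ} (c : Finset σ → M) (b : KoszulIndex.{u} σ n) :
    restrictCard R n c b = c b.down.1 := rfl

theorem extendZero_restrictCard {n : ℕ} {c : Finset σ → M} (hc : ∀ I, I.card ≠ n → c I = 0) :
    extendZero R n (restrictCard.{u} R n c) = c := by
  ext I
  by_cases h : I.card = n
  · exact extendZero_apply (R := R) (restrictCard.{u} R n c) ⟨I, h⟩
  · rw [extendZero_of_card_ne _ h, hc I h]

variable [LinearOrder σ]

theorem koszulD_of_card_ne {x : σ → R} {n : ℕ} {c : Finset σ → M}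
    (hc : ∀ I, I.card ≠ n + 1 → c I = 0) {J : Finset σ} (hJ : J.card ≠ n) :
    koszulD x c J = 0 := by
  refine Finset.sum_eq_zero fun j hj => ?_
  rw [hc, smul_zero, smul_zero]
  rw [Finset.card_insert_of_notMem (Finset.mem_compl.1 hj)]
  omega

theorem koszulD_eq_zero_of_card_ne_zero {x : σ → R} {c : Finset σ → M}
    (hc : ∀ I, I.card ≠ 0 → c I = 0) : koszulD x c = 0 := by
  ext J
  refine Finset.sum_eq_zero fun j _ => ?_
  rw [hc, smul_zero, smul_zero]
  simp

/-- The Koszul differential from the `(n + 1)`-st to the `n`-th term. -/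
def koszulMap (x : σ → R) (n : ℕ) :
    (KoszulIndex.{u} σ (n + 1) →₀ M) →ₗ[R] (KoszulIndex.{u} σ n →₀ M) :=
  restrictCard R n ∘ₗ koszulD x ∘ₗ extendZero R (n + 1)

theorem extendZero_koszulMap (x : σ → R) (n : ℕ) (f : KoszulIndex.{u} σ (n + 1) →₀ M) :
    extendZero R n (koszulMap x n f) = koszulD x (extendZero R (n + 1) f) :=
  extendZero_restrictCard fun _ hI =>
    koszulD_of_card_ne (fun _ hI' => extendZero_of_card_ne f hI') hI

section Exactness

variable {k : Type u} [Field k]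

/-- A Koszul cycle is homologous to one whose support avoids a given set of variables. -/
theorem exists_koszulD_sub_disjoint (A : Finset σ) {n : ℕ} {c : Finset σ → MvPolynomial σ k}
    (hc : ∀ I, I.card ≠ n + 1 → c I = 0) (hD : koszulD (X : σ → MvPolynomial σ k) c = 0) :
    ∃ y : Finset σ → MvPolynomial σ k, (∀ I, I.card ≠ n + 1 + 1 → y I = 0) ∧
      ∀ J, ¬ Disjoint J A → c J - koszulD (X : σ → MvPolynomial σ k) y J = 0 := by
  induction A using Finset.induction_on with
  | empty => exact ⟨0, fun _ _ => rfl, fun J hJ => absurd (Finset.disjoint_empty_right _) hJ⟩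
  | insert b A _ ih =>
    obtain ⟨y, hy, hyA⟩ := ih
    set z := c - koszulD (X : σ → MvPolynomial σ k) y with hz
    have hDz : koszulD (X : σ → MvPolynomial σ k) z = 0 := by rw [hz, map_sub, hD, koszulD_koszulD, sub_zero]
    have hzc : ∀ I, I.card ≠ n + 1 → z I = 0 := fun I hI => by
      rw [hz, Pi.sub_apply, hc I hI, koszulD_of_card_ne hy hI, sub_zero]
    have key : ∀ J, koszulD (X : σ → MvPolynomial σ k) (koszulContraction b (divX b) z) J =
        if b ∈ J then z J else (X b : MvPolynomial σ k) • divX b (z J) := by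
      intro J
      rw [← koszul_homotopy (divX_X_mul_self b) (fun j hj => divX_X_mul hj) z J, hDz]
      simp [koszulContraction]
    refine ⟨y + koszulContraction b (divX b) z, fun I hI => ?_, fun J hJ => ?_⟩
    · rw [Pi.add_apply, hy I hI, zero_add, koszulContraction]
      split_ifs with hb
      · rw [hzc, map_zero, smul_zero]
        rw [Finset.card_erase_of_mem hb]
        have := Finset.card_pos.2 ⟨b, hb⟩
        omega
      · rfl
    -- At sets containing `b` the contraction reproduces `z` and cancels it. At the other sets it
    -- changes `z J` by a multiple of `divX b (z J)`, which is zero wherever `z` already vanished,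
    -- so earlier progress is kept.
    · rw [map_add, Pi.add_apply, ← sub_sub, key]
      change z J - _ = 0
      split_ifs with hb
      · exact sub_self _
      · rw [show z J = 0 from hyA J fun h => hJ (Finset.disjoint_insert_right.2 ⟨hb, h⟩)]
        simp

/-- Once all variables have been removed from the support, only the empty set could remain, and it
does not have `n + 1` elements. -/
theorem koszulMap_exact (n : ℕ) : Function.Exact
    (koszulMap.{u} (M := MvPolynomial σ k) (X : σ → MvPolynomial σ k) (n + 1))
    (koszulMap.{u} (X : σ → MvPolynomial σ k) n) := by
  intro f
  constructor
  · intro hf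
    have hD : koszulD (X : σ → MvPolynomial σ k) (extendZero (MvPolynomial σ k) (n + 1) f) = 0 := by
      rw [← extendZero_koszulMap, hf, map_zero]
    obtain ⟨y, hy, hyc⟩ := exists_koszulD_sub_disjoint Finset.univ
      (fun I hI => extendZero_of_card_ne (R := MvPolynomial σ k) f hI) hD
    refine ⟨restrictCard (MvPolynomial σ k) _ y, extendZero_injective (R := MvPolynomial σ k) ?_⟩
    rw [extendZero_koszulMap, extendZero_restrictCard hy]
    ext1 J
    by_cases hJ : J.card = n + 1
    · refine (sub_eq_zero.1 (hyc J fun h => ?_)).symm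
      have : J = ∅ := Finset.disjoint_self_iff_empty J |>.1 (h.mono_right (Finset.subset_univ J))
      simp [this] at hJ
    · rw [koszulD_of_card_ne hy hJ, extendZero_of_card_ne f hJ]
  · rintro ⟨g, rfl⟩
    refine extendZero_injective (R := MvPolynomial σ k) ?_
    rw [extendZero_koszulMap, extendZero_koszulMap, koszulD_koszulD, map_zero]

/-- The degree of a Koszul basis element. -/
def koszulDegree (w : σ → ℤ) (n : ℕ) (b : KoszulIndex.{u} σ n) : ℤ := ∑ j ∈ b.down.1, w j

variable (k) in
/-- The Koszul complex as a graded free resolution of the residue field. -/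
abbrev koszulResolution (w : σ → ℤ) :
    GradedFreeResolution k w (ResidueModule k σ) (residueDegree k w) where
  ι n := KoszulIndex.{u} σ n
  deg n := koszulDegree w n
  d n := koszulMap (X : σ → MvPolynomial σ k) n
  ε := (Submodule.mkQ _).comp (Finsupp.lapply ⟨∅, Finset.card_empty⟩)
  d_degree n b b' := by
    change koszulD (X : σ → MvPolynomial σ k) (extendZero (MvPolynomial σ k) (n + 1) (Finsupp.single b 1)) b'.down.1 ∈ _
    rw [extendZero_single, koszulD_apply]
    refine Submodule.sum_mem _ fun j hj => zsmul_mem ?_ _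
    by_cases h : insert j b'.down.1 = b.down.1
    · rw [h, Pi.single_eq_same, smul_eq_mul, mul_one, koszulDegree, koszulDegree, ← h,
        Finset.sum_insert (Finset.mem_compl.1 hj), add_sub_cancel_right]
      exact isWeightedHomogeneous_X k w j
    · rw [Pi.single_eq_of_ne h, smul_zero]
      exact Submodule.zero_mem _
  ε_degree b := by
    obtain ⟨I, hI⟩ := b
    obtain rfl := Finset.card_eq_zero.1 hI
    refine ⟨1, ?_, ?_⟩
    · simpa [koszulDegree] using isWeightedHomogeneous_one k w
    · change _ = Submodule.mkQ _ ((Finsupp.single _ (1 : MvPolynomial σ k)) _)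
      rw [Finsupp.single_eq_same]
      rfl
  ε_surjective y := by
    obtain ⟨p, rfl⟩ := Submodule.mkQ_surjective _ y
    refine ⟨Finsupp.single ⟨∅, Finset.card_empty⟩ p, ?_⟩
    change Submodule.mkQ _ ((Finsupp.single _ p) _) = _
    rw [Finsupp.single_eq_same]
  exact_ε f := by
    refine (Submodule.Quotient.mk_eq_zero _).trans ?_
    have hval : ∀ c : Finset σ → MvPolynomial σ k,
        koszulD (X : σ → MvPolynomial σ k) c ∅ = ∑ j, c {j} * X j := by
      intro c
      rw [koszulD_apply, Finset.compl_empty]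
      refine Finset.sum_congr rfl fun j _ => ?_
      simp [koszulSign, mul_comm]
    rw [Finsupp.lapply_apply, Ideal.mem_span_range_iff_exists_fun]
    constructor
    · rintro ⟨g, hg⟩
      -- The coefficients `g` are placed on the singletons; the element chosen from `{j}` can only
      -- be `j`.
      refine ⟨restrictCard (MvPolynomial σ k) _ fun I => if h : I.card = 1 then g (Finset.card_eq_one.1 h).choose
        else 0, ?_⟩
      ext1 b
      obtain ⟨I, hI⟩ := b
      obtain rfl := Finset.card_eq_zero.1 hI
      rw [koszulMap, LinearMap.comp_apply, LinearMap.comp_apply, restrictCard_apply,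
        extendZero_restrictCard (fun I hI => dif_neg hI), hval, ← hg]
      refine Finset.sum_congr rfl fun j _ => ?_
      rw [dif_pos (Finset.card_singleton j)]
      congr 2
      have := (Finset.card_eq_one.1 (Finset.card_singleton j)).choose_spec
      exact (Finset.singleton_injective this).symm
    · rintro ⟨g, rfl⟩
      exact ⟨_, (hval _).symm⟩
  exact_d n := koszulMap_exact n

end Exactness

end KoszulResolution

/-! ### The Betti numbers through the strands of the Koszul complex -/

section Subquotient

variable {k V W : Type*} [Field k] [AddCommGroup V] [Module k V] [AddCommGroup W] [Module k W]

/-- Injectivity of `f` is needed only modulo `B`. This allows its use both for the passage to a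
strand and for the restriction to Apéry cells, which forgets part of a cycle. -/
theorem nonempty_subquotient_equiv (f : V →ₗ[k] W) {Z B : Submodule k V} {Z' B' : Submodule k W}
    (hZ : Z.map f = Z') (hB : ∀ z ∈ Z, f z ∈ B' ↔ z ∈ B) :
    Nonempty ((Z ⧸ B.comap Z.subtype) ≃ₗ[k] (Z' ⧸ B'.comap Z'.subtype)) := by
  subst hZ
  let g : Z →ₗ[k] (Z.map f ⧸ B'.comap (Z.map f).subtype) :=
    (Submodule.mkQ _) ∘ₗ (f.submoduleMap Z)
  have hg : Function.Surjective g :=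
    (Submodule.mkQ_surjective _).comp (f.submoduleMap_surjective Z)
  have hk : LinearMap.ker g = B.comap Z.subtype := by
    ext z
    rw [LinearMap.mem_ker, Submodule.mem_comap]
    exact (Submodule.Quotient.mk_eq_zero _).trans (hB z z.2)
  exact ⟨(Submodule.quotEquivOfEq _ _ hk).symm ≪≫ₗ g.quotKerEquivOfSurjective hg⟩

end Subquotient

section TensorKoszul

variable {σ : Type v} [Fintype σ] [LinearOrder σ] {R : Type*} [CommRing R]
  {M : Type*} [AddCommGroup M] [Module R M]

theorem finsuppScalarRight_lTensor_koszulMap (x : σ → R) (n : ℕ)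
    (t : M ⊗[R] (KoszulIndex.{u} σ (n + 1) →₀ R)) :
    finsuppScalarRight R R M _ (LinearMap.lTensor M (koszulMap x n) t) =
      koszulMap x n (finsuppScalarRight R R M _ t) := by
  induction t using TensorProduct.induction_on with
  | zero => simp
  | add t t' h h' => rw [map_add, map_add, h, h', map_add, map_add]
  | tmul m p =>
    have hext : ∀ I, extendZero R (n + 1) (finsuppScalarRight R R M _ (m ⊗ₜ p)) I =
        extendZero R (n + 1) p I • m := by
      intro I
      by_cases h : I.card = n + 1
      · have h1 := extendZero_apply (R := R) (finsuppScalarRight R R M _ (m ⊗ₜ p))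
          (⟨I, h⟩ : KoszulIndex.{u} σ (n + 1))
        have h2 := extendZero_apply (R := R) p ⟨I, h⟩
        rw [finsuppScalarRight_apply_tmul_apply, ← h2] at h1
        exact h1
      · rw [extendZero_of_card_ne _ h, extendZero_of_card_ne _ h, zero_smul]
    ext b
    rw [LinearMap.lTensor_tmul, finsuppScalarRight_apply_tmul_apply]
    change koszulD x (extendZero R (n + 1) p) b.down.1 • m =
      koszulD x (extendZero R (n + 1) (finsuppScalarRight R R M _ (m ⊗ₜ p))) b.down.1
    rw [koszulD_apply, koszulD_apply, Finset.sum_smul]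
    refine Finset.sum_congr rfl fun j _ => ?_
    rw [hext, smul_assoc, smul_assoc]

end TensorKoszul

theorem sum_insert_of_mem_compl {σ : Type v} [Fintype σ] [LinearOrder σ] (w : σ → ℤ) {j : σ}
    {J : Finset σ} (hj : j ∈ Jᶜ) : ∑ g ∈ insert j J, w g = w j + ∑ g ∈ J, w g :=
  Finset.sum_insert (Finset.mem_compl.1 hj)

/-! ### The squarefree divisor complex -/

section DivisorComplex

variable (k : Type u) [Field k] {σ : Type v}

/-- The families of scalars that vanish at all sets without the property `P`. -/
def supportedOn (P : Finset σ → Prop) : Submodule k (Finset σ → k) where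
  carrier := {c | ∀ I, c I ≠ 0 → P I}
  zero_mem' I h := absurd rfl h
  add_mem' {c c'} hc hc' I h := by
    by_cases h0 : c I = 0
    · refine hc' I fun h1 => h ?_
      rw [Pi.add_apply, h0, h1, add_zero]
    · exact hc I h0
  smul_mem' r c hc I h := hc I fun h0 => h (by rw [Pi.smul_apply, h0, smul_zero])

/-- The chains of the squarefree divisor complex of `s`: they are supported on the
`i`-element sets of variables whose total degree can be subtracted from `s` within `Q`. -/
def divisorChains (w : σ → ℤ) (Q : Set ℤ) (i : ℕ) (s : ℤ) : Submodule k (Finset σ → k) :=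
  supportedOn k fun I => I.card = i ∧ s - ∑ g ∈ I, w g ∈ Q

variable [Fintype σ] [LinearOrder σ]

/-- The cycles of the squarefree divisor complex. -/
def divisorCycles (w : σ → ℤ) (Q : Set ℤ) (i : ℕ) (s : ℤ) : Submodule k (Finset σ → k) :=
  divisorChains k w Q i s ⊓ LinearMap.ker (koszulD (1 : σ → k))

/-- The boundaries of the squarefree divisor complex. -/
def divisorBoundaries (w : σ → ℤ) (Q : Set ℤ) (i : ℕ) (s : ℤ) : Submodule k (Finset σ → k) :=
  (divisorChains k w Q (i + 1) s).map (koszulD (1 : σ → k))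

end DivisorComplex

/-- The elements of a subsemigroup of `ℕ`, as integers. -/
def intElements (S : AddSubmonoid ℕ) : Set ℤ := {e | ∃ u ∈ S, (u : ℤ) = e}

/-! ### Degree strands of the Koszul complex of a semigroup ring -/

section Strand

variable {k : Type u} [Field k] {S : AddSubmonoid ℕ}

open Classical in
/-- The coefficient of `t ^ e` of an element of the semigroup ring. -/
def coefAt (k : Type u) [Field k] (S : AddSubmonoid ℕ) (e : ℤ) : SemigroupRing k S →ₗ[k] k where
  toFun f := if h : 0 ≤ e ∧ e.toNat ∈ S then f.coeff ⟨e.toNat, h.2⟩ else 0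
  map_add' f g := by split_ifs <;> simp
  map_smul' r f := by split_ifs <;> simp

theorem coefAt_natCast (u : S) (f : SemigroupRing k S) : coefAt k S ((u : ℕ) : ℤ) f = f.coeff u :=
  dif_pos (⟨by positivity, by simp⟩ : (0 : ℤ) ≤ ((u : ℕ) : ℤ) ∧ ((u : ℕ) : ℤ).toNat ∈ S)

theorem coefAt_of_forall_ne {e : ℤ} (h : ∀ u ∈ S, (u : ℤ) ≠ e) (f : SemigroupRing k S) :
    coefAt k S e f = 0 :=
  dif_neg fun h' => h _ h'.2 (Int.toNat_of_nonneg h'.1)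

theorem X_smul_semigroupRing (g : minGens S) (f : SemigroupRing k S) :
    (X g : GenPoly k S) • f = AddMonoidAlgebra.single ⟨g, g.2.1⟩ 1 * f := by
  rw [Algebra.smul_def]
  congr 1
  exact aeval_X _ g

theorem coefAt_X_smul (g : minGens S) (e : ℤ) (f : SemigroupRing k S) :
    coefAt k S e ((X g : GenPoly k S) • f) = coefAt k S (e - genWeight S g) f := by
  rw [X_smul_semigroupRing, genWeight]
  by_cases h : ∃ u ∈ S, (u : ℤ) = e - ((g : ℕ) : ℤ)
  · obtain ⟨u, hu, hue⟩ := h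
    obtain rfl : e = (((⟨g, g.2.1⟩ + ⟨u, hu⟩ : S) : ℕ) : ℤ) := by
      push_cast
      omega
    rw [coefAt_natCast, ← hue, show (u : ℤ) = (((⟨u, hu⟩ : S) : ℕ) : ℤ) from rfl, coefAt_natCast,
      AddMonoidAlgebra.coeff_single_mul_eq_mul_coeff (⟨u, hu⟩ : S), one_mul]
    simp
  · push Not at h
    rw [coefAt_of_forall_ne h]
    by_cases h' : ∃ u ∈ S, (u : ℤ) = e
    · obtain ⟨u, hu, rfl⟩ := h'
      rw [show (u : ℤ) = (((⟨u, hu⟩ : S) : ℕ) : ℤ) from rfl, coefAt_natCast]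
      refine AddMonoidAlgebra.coeff_single_mul_of_forall_add_ne _ _ fun d hd => h d d.2 ?_
      have := congrArg (fun s : S => ((s : ℕ) : ℤ)) hd
      push_cast at this
      omega
    · push Not at h'
      exact coefAt_of_forall_ne h' _

theorem coefAt_monomial_smul (β : minGens S →₀ ℕ) (c : k) (e : ℤ) (f : SemigroupRing k S) :
    coefAt k S e ((monomial β c : GenPoly k S) • f) =
      c * coefAt k S (e - Finsupp.weight (genWeight S) β) f := by
  induction β using Finsupp.induction_linear generalizing c e f with
  | zero =>
    rw [map_zero, sub_zero]
    change coefAt k S e ((C c : GenPoly k S) • f) = _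
    rw [← algebraMap_eq, algebraMap_smul, map_smul, smul_eq_mul]
  | add β β' h h' =>
    rw [← mul_one c, ← monomial_mul, mul_smul, h, h', map_add, one_mul, mul_one, sub_sub]
  | single g n =>
    induction n generalizing c e f with
    | zero =>
      rw [Finsupp.single_zero, map_zero, sub_zero]
      change coefAt k S e ((C c : GenPoly k S) • f) = _
      rw [← algebraMap_eq, algebraMap_smul, map_smul, smul_eq_mul]
    | succ n ih =>
      rw [Finsupp.single_add, ← mul_one c, ← monomial_mul, mul_smul, ih, mul_one, map_add]
      change c * coefAt k S _ ((X g : GenPoly k S) • f) = _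
      rw [coefAt_X_smul, Finsupp.weight_single, Finsupp.weight_single, sub_sub]
      simp

theorem mem_semigroupRingDegree_iff {e : ℤ} {f : SemigroupRing k S} :
    f ∈ semigroupRingDegree k S e ↔ ∀ e' ≠ e, coefAt k S e' f = 0 := by
  constructor
  · intro hf e' he'
    by_cases h : ∃ u ∈ S, (u : ℤ) = e'
    · obtain ⟨u, hu, rfl⟩ := h
      by_contra hne
      rw [show (u : ℤ) = (((⟨u, hu⟩ : S) : ℕ) : ℤ) from rfl, coefAt_natCast] at hne
      exact he' (hf _ (Finsupp.mem_support_iff.2 hne))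
    · push Not at h
      exact coefAt_of_forall_ne h _
  · intro h u hu
    by_contra hne
    rw [Finsupp.mem_support_iff, ← coefAt_natCast] at hu
    exact hu (h _ hne)

theorem eq_zero_of_coefAt_eq_zero {e : ℤ} {f : SemigroupRing k S}
    (hf : f ∈ semigroupRingDegree k S e) (h : coefAt k S e f = 0) : f = 0 := by
  rw [mem_semigroupRingDegree_iff] at hf
  ext u
  rw [← coefAt_natCast]
  by_cases hu : ((u : ℕ) : ℤ) = e
  · rw [hu, h]
    rfl
  · rw [hf _ hu]
    rfl

theorem smul_mem_semigroupRingDegree {a b : ℤ} {p : GenPoly k S} {f : SemigroupRing k S}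
    (hp : p ∈ weightedHomogeneousSubmodule k (genWeight S) a)
    (hf : f ∈ semigroupRingDegree k S b) : p • f ∈ semigroupRingDegree k S (a + b) := by
  rw [p.as_sum, Finset.sum_smul]
  refine Submodule.sum_mem _ fun β hβ => ?_
  rw [mem_semigroupRingDegree_iff] at hf ⊢
  intro e he
  have hw := hp (mem_support_iff.1 hβ)
  rw [coefAt_monomial_smul, hw, hf, mul_zero]
  omega

/-- The strand of degree `s` of the Koszul complex of the semigroup ring. -/
def strand (k : Type u) [Field k] (S : AddSubmonoid ℕ) (s : ℤ) :
    (Finset (minGens S) → SemigroupRing k S) →ₗ[k] (Finset (minGens S) → k) where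
  toFun c I := coefAt k S (s - ∑ g ∈ I, genWeight S g) (c I)
  map_add' c c' := by ext I; simp
  map_smul' r c := by ext I; simp

theorem strand_apply (s : ℤ) (c : Finset (minGens S) → SemigroupRing k S)
    (I : Finset (minGens S)) :
    strand k S s c I = coefAt k S (s - ∑ g ∈ I, genWeight S g) (c I) := rfl

variable [Fintype (minGens S)]

/-- Multiplication by a variable only shifts coefficients, so on coefficients every variable acts as
1. -/
theorem strand_koszulD (s : ℤ) (c : Finset (minGens S) → SemigroupRing k S) :
    strand k S s (koszulD (X : minGens S → GenPoly k S) c) =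
      koszulD (1 : minGens S → k) (strand k S s c) := by
  ext J
  rw [strand_apply, koszulD_apply, koszulD_apply, map_sum]
  refine Finset.sum_congr rfl fun j hj => ?_
  rw [map_zsmul, coefAt_X_smul, strand_apply, sum_insert_of_mem_compl _ hj,
    Pi.one_apply, one_smul, sub_sub, add_comm (genWeight S j)]

/-- The strand of degree `s` of an element of a term of the Koszul complex of `k[S]`. -/
def tensorStrand (k : Type u) [Field k] (S : AddSubmonoid ℕ) [Fintype (minGens S)]
    (i : ℕ) (s : ℤ) :
    (SemigroupRing k S ⊗[GenPoly k S] (KoszulIndex.{u} (minGens S) i →₀ GenPoly k S)) →ₗ[k]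
      (Finset (minGens S) → k) :=
  strand k S s ∘ₗ
    (extendZero (GenPoly k S) i ∘ₗ
      (finsuppScalarRight (GenPoly k S) (GenPoly k S) (SemigroupRing k S) _).toLinearMap
      ).restrictScalars k

theorem tensorStrand_apply (i : ℕ) (s : ℤ)
    (t : SemigroupRing k S ⊗[GenPoly k S] (KoszulIndex.{u} (minGens S) i →₀ GenPoly k S)) :
    tensorStrand k S i s t = strand k S s (extendZero (GenPoly k S) i
      (finsuppScalarRight (GenPoly k S) (GenPoly k S) (SemigroupRing k S) _ t)) := rfl

theorem tensorStrand_tensorD (i : ℕ) (s : ℤ)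
    (t : SemigroupRing k S ⊗[GenPoly k S] (KoszulIndex.{u} (minGens S) (i + 1) →₀ GenPoly k S)) :
    tensorStrand k S i s
        ((koszulResolution k (genWeight S)).tensorD (SemigroupRing k S) i t) =
      koszulD (1 : minGens S → k) (tensorStrand k S (i + 1) s t) := by
  change tensorStrand k S i s (LinearMap.lTensor _ (koszulMap _ i) t) = _
  rw [tensorStrand_apply, tensorStrand_apply, ← strand_koszulD, ← extendZero_koszulMap]
  exact congrArg (fun f => strand k S s (extendZero (GenPoly k S) i f))
    (finsuppScalarRight_lTensor_koszulMap (X : minGens S → GenPoly k S) i t)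

theorem finsuppScalarRight_mem_degree {i : ℕ} {s : ℤ}
    {t : SemigroupRing k S ⊗[GenPoly k S] (KoszulIndex.{u} (minGens S) i →₀ GenPoly k S)}
    (ht : t ∈ (koszulResolution k (genWeight S)).tensorDegree (SemigroupRing k S)
      (semigroupRingDegree k S) i s) (b : KoszulIndex.{u} (minGens S) i) :
    finsuppScalarRight (GenPoly k S) (GenPoly k S) (SemigroupRing k S) _ t b ∈
      semigroupRingDegree k S (s - koszulDegree (genWeight S) i b) := by
  refine Submodule.span_induction (p := fun t _ => finsuppScalarRight (GenPoly k S) (GenPoly k S)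
    (SemigroupRing k S) (KoszulIndex.{u} (minGens S) i) t b ∈
      semigroupRingDegree k S (s - koszulDegree (genWeight S) i b)) ?_ ?_ ?_ ?_ ht
  · rintro _ ⟨a, e, hae, m, hm, f, hf, rfl⟩
    rw [finsuppScalarRight_apply_tmul_apply]
    have := smul_mem_semigroupRingDegree (hf b) hm
    rwa [show e - koszulDegree (genWeight S) i b + a = s - koszulDegree (genWeight S) i b by
      omega] at this
  · rw [map_zero]
    exact Submodule.zero_mem _
  · intro x y _ _ hx hy
    rw [map_add]
    exact Submodule.add_mem _ hx hy
  · intro r x _ hx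
    have : finsuppScalarRight (GenPoly k S) (GenPoly k S) (SemigroupRing k S)
        (KoszulIndex.{u} (minGens S) i) (r • x) = r • finsuppScalarRight (GenPoly k S)
        (GenPoly k S) (SemigroupRing k S) (KoszulIndex.{u} (minGens S) i) x := by
      rw [← algebraMap_smul (GenPoly k S) r x, map_smul, algebraMap_smul]
    rw [this]
    exact Submodule.smul_mem _ r hx

/-- Each coordinate of `t` is homogeneous of a known degree, hence determined by a single
coefficient. -/
theorem tensorStrand_injOn {i : ℕ} {s : ℤ}
    {t : SemigroupRing k S ⊗[GenPoly k S] (KoszulIndex.{u} (minGens S) i →₀ GenPoly k S)}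
    (ht : t ∈ (koszulResolution k (genWeight S)).tensorDegree (SemigroupRing k S)
      (semigroupRingDegree k S) i s) (h : tensorStrand k S i s t = 0) : t = 0 := by
  refine (finsuppScalarRight (GenPoly k S) (GenPoly k S) (SemigroupRing k S)
    (KoszulIndex.{u} (minGens S) i)).injective ?_
  rw [map_zero]
  ext1 b
  refine eq_zero_of_coefAt_eq_zero (finsuppScalarRight_mem_degree ht b) ?_
  have := congrFun h b.down.1
  rwa [tensorStrand_apply, strand_apply, extendZero_apply] at this

theorem map_tensorStrand_tensorDegree (i : ℕ) (s : ℤ) :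
    ((koszulResolution k (genWeight S)).tensorDegree (SemigroupRing k S)
      (semigroupRingDegree k S) i s).map (tensorStrand k S i s) = divisorChains k (genWeight S) (intElements S) i s := by
  apply le_antisymm
  · rintro _ ⟨t, ht, rfl⟩ I hI
    rw [tensorStrand_apply, strand_apply] at hI
    have hcard : I.card = i := by
      by_contra h
      rw [extendZero_of_card_ne _ h, map_zero] at hI
      exact hI rfl
    refine ⟨hcard, ?_⟩
    by_contra h
    exact hI (coefAt_of_forall_ne (fun u hu hue => h ⟨u, hu, hue⟩) _)
  · intro c hc
    -- A nonzero scalar sits only where the remaining degree belongs to `S`, so it is realised by a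
    -- monomial of that degree.
    have hex : ∀ b : KoszulIndex.{u} (minGens S) i, ∃ m ∈ semigroupRingDegree k S
        (s - koszulDegree (genWeight S) i b),
        coefAt k S (s - koszulDegree (genWeight S) i b) m = c b.down.1 := by
      intro b
      by_cases h0 : c b.down.1 = 0
      · exact ⟨0, Submodule.zero_mem _, by rw [h0, map_zero]⟩
      · obtain ⟨-, u, hu, hus⟩ := hc _ h0
        have hue : s - koszulDegree (genWeight S) i b = (((⟨u, hu⟩ : S) : ℕ) : ℤ) := by
          exact hus.symm
        refine ⟨AddMonoidAlgebra.single ⟨u, hu⟩ (c b.down.1), ?_, ?_⟩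
        · rw [hue]
          exact AddMonoidAlgebra.single_mem_gradeBy (fun s : S => ((s : ℕ) : ℤ)) _ _
        · rw [hue, coefAt_natCast]
          simp
    choose m hm hmc using hex
    refine ⟨∑ b, m b ⊗ₜ Finsupp.single b 1, Submodule.sum_mem _ fun b _ => ?_, ?_⟩
    · refine Submodule.subset_span ⟨_, _, sub_add_cancel s (koszulDegree (genWeight S) i b), m b,
        hm b, _, ?_, rfl⟩
      exact isDegreeZero_id (deg := koszulDegree (genWeight S) i) b
    · ext I
      rw [tensorStrand_apply, strand_apply]
      by_cases h : I.card = i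
      · let b : KoszulIndex.{u} (minGens S) i := ⟨I, h⟩
        rw [show I = b.down.1 from rfl, extendZero_apply, map_sum, Finsupp.finsetSum_apply,
          Finset.sum_eq_single b]
        · rw [finsuppScalarRight_apply_tmul_apply, Finsupp.single_eq_same, one_smul]
          exact hmc b
        · intro b' _ hb'
          rw [finsuppScalarRight_apply_tmul_apply, Finsupp.single_eq_of_ne' hb', zero_smul]
        · exact fun h => absurd (Finset.mem_univ _) h
      · rw [extendZero_of_card_ne _ h, map_zero]
        by_contra hne
        exact h (hc I (Ne.symm hne)).1

theorem koszulD_divisorChains_zero {s : ℤ} {c : Finset (minGens S) → k}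
    (hc : c ∈ divisorChains k (genWeight S) (intElements S) 0 s) : koszulD (1 : minGens S → k) c = 0 := by
  refine koszulD_eq_zero_of_card_ne_zero fun I hI => ?_
  by_contra h
  exact hI (hc I h).1

theorem map_tensorStrand_cycles (i : ℕ) (s : ℤ) :
    ((koszulResolution k (genWeight S)).cycles (SemigroupRing k S)
      (semigroupRingDegree k S) i s).map (tensorStrand k S i s) = divisorCycles k (genWeight S) (intElements S) i s := by
  rw [divisorCycles, ← map_tensorStrand_tensorDegree]
  cases i with
  | zero =>
    refine (inf_eq_left.2 fun c hc => ?_).symm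
    refine koszulD_divisorChains_zero (s := s) ?_
    rw [← map_tensorStrand_tensorDegree]
    exact hc
  | succ i =>
    apply le_antisymm
    · rintro _ ⟨t, ht, rfl⟩
      refine ⟨⟨t, ht.1, rfl⟩, ?_⟩
      rw [SetLike.mem_coe, LinearMap.mem_ker, ← tensorStrand_tensorD, LinearMap.mem_ker.1 ht.2,
        map_zero]
    · rintro _ ⟨⟨t, ht, rfl⟩, hD⟩
      refine ⟨t, ⟨ht, ?_⟩, rfl⟩
      rw [SetLike.mem_coe, LinearMap.mem_ker, ← tensorStrand_tensorD] at hD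
      exact tensorStrand_injOn
        (lTensor_mem_tensorDegree _ _ ((koszulResolution k (genWeight S)).d_degree i) ht) hD

theorem GradedFreeResolution.cycles_le_tensorDegree {σ : Type v} {w : σ → ℤ}
    {N : Type*} [AddCommGroup N] [Module (MvPolynomial σ k) N] [Module k N]
    {𝓝 : ℤ → Submodule k N} (F : GradedFreeResolution k w N 𝓝)
    (M : Type*) [AddCommGroup M] [Module (MvPolynomial σ k) M] [Module k M]
    [IsScalarTower k (MvPolynomial σ k) M] (𝓜 : ℤ → Submodule k M) (i : ℕ) (s : ℤ) :
    F.cycles M 𝓜 i s ≤ F.tensorDegree M 𝓜 i s := by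
  cases i with
  | zero => exact le_rfl
  | succ i => exact inf_le_left

/-- The Betti numbers are the dimensions of the homology of the squarefree divisor complexes. -/
theorem gradedBetti_eq_finrank (k : Type u) [Field k] (S : AddSubmonoid ℕ) [Fintype (minGens S)]
    (i : ℕ) (s : ℤ) :
    gradedBetti k S i s = Module.finrank k (divisorCycles k (genWeight S) (intElements S) i s ⧸
      (divisorBoundaries k (genWeight S) (intElements S) i s).comap (divisorCycles k (genWeight S) (intElements S) i s).subtype) := by
  obtain ⟨e₁⟩ := nonempty_gradedTor_equiv
    (Classical.choice (nonempty_gradedFreeResolution k (genWeight S)))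
    (koszulResolution k (genWeight S)) (SemigroupRing k S) (semigroupRingDegree k S) i s
  obtain ⟨e₂⟩ := nonempty_subquotient_equiv (tensorStrand k S i s)
    (map_tensorStrand_cycles (k := k) (S := S) i s)
    (B := (koszulResolution k (genWeight S)).boundaries (SemigroupRing k S)
      (semigroupRingDegree k S) i s) (B' := divisorBoundaries k (genWeight S) (intElements S) i s) (by
    intro z hz
    constructor
    · rintro ⟨c, hc, hcz⟩
      rw [SetLike.mem_coe, ← map_tensorStrand_tensorDegree] at hc
      obtain ⟨t, ht, rfl⟩ := hc
      refine ⟨t, ht, ?_⟩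
      rw [← tensorStrand_tensorD] at hcz
      refine sub_eq_zero.1 (tensorStrand_injOn (i := i) (s := s) (Submodule.sub_mem _
        (lTensor_mem_tensorDegree _ _ ((koszulResolution k (genWeight S)).d_degree i) ht)
        (GradedFreeResolution.cycles_le_tensorDegree _ _ _ i s hz)) ?_)
      exact (map_sub _ _ _).trans (sub_eq_zero.2 hcz)
    · rintro ⟨t, ht, rfl⟩
      refine ⟨tensorStrand k S (i + 1) s t, ?_, (tensorStrand_tensorD i s t).symm⟩
      rw [SetLike.mem_coe, ← map_tensorStrand_tensorDegree]
      exact ⟨t, ht, rfl⟩)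
  exact (e₁ ≪≫ₗ e₂).finrank_eq

end Strand

/-! ### Divisor complexes of semigroups of maximal embedding dimension -/

section MaximalEmbeddingDimension

variable {k : Type u} [Field k] {σ : Type v}

theorem finrank_supportedOn [Finite σ] (P : Finset σ → Prop) :
    Module.finrank k (supportedOn k P) = Nat.card {J // P J} := by
  classical
  have := Fintype.ofFinite σ
  let e : supportedOn k P ≃ₗ[k] ({J // P J} → k) :=
    { toFun := fun c J => c.1 J.1
      map_add' := fun _ _ => rfl
      map_smul' := fun _ _ => rfl
      invFun := fun f => ⟨fun J => if h : P J then f ⟨J, h⟩ else 0, fun J hJ => by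
        by_contra h
        exact hJ (dif_neg h)⟩
      left_inv := fun c => by
        ext J
        change (if h : P J then c.1 J else 0) = c.1 J
        split_ifs with h
        · rfl
        · by_contra hne
          exact h (c.2 J (Ne.symm hne))
      right_inv := fun f => by
        ext J
        exact dif_pos J.2 }
  rw [e.finrank_eq, Module.finrank_fintype_fun_eq_card, Nat.card_eq_fintype_card]

/-- The properties of the degrees `w` of the generators of a numerical semigroup of maximal
embedding dimension with set of elements `Q` and multiplicity `w a`. -/
structure IsMaximalEmbedding (w : σ → ℤ) (Q : Set ℤ) (a : σ) : Prop where
  zero_mem : 0 ∈ Q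
  add_mem : ∀ u ∈ Q, ∀ l, u + w l ∈ Q
  eq_of_sub_mem : ∀ j l, w j - w l ∈ Q → j = l
  add_sub_mem : ∀ j ≠ a, ∀ l ≠ a, w j + w l - w a ∈ Q
  eq_of_sub_notMem : ∀ u ∈ Q, u - w a ∉ Q → u = 0 ∨ ∃ j ≠ a, w j = u

open Classical in
/-- Restriction of a family to the sets with the property `P`. -/
def restrictTo (k : Type u) [Field k] (P : Finset σ → Prop) :
    (Finset σ → k) →ₗ[k] (Finset σ → k) where
  toFun c I := if P I then c I else 0
  map_add' c c' := by
    ext I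
    by_cases h : P I <;> simp [h]
  map_smul' r c := by
    ext I
    by_cases h : P I <;> simp [h]

theorem restrictTo_of_pos {P : Finset σ → Prop} {c : Finset σ → k} {I : Finset σ} (h : P I) :
    restrictTo k P c I = c I := if_pos h

theorem restrictTo_of_neg {P : Finset σ → Prop} {c : Finset σ → k} {I : Finset σ} (h : ¬ P I) :
    restrictTo k P c I = 0 := if_neg h

theorem of_restrictTo_ne_zero {P : Finset σ → Prop} {c : Finset σ → k} {I : Finset σ}
    (h : restrictTo k P c I ≠ 0) : P I ∧ c I ≠ 0 := by
  by_cases hP : P I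
  · exact ⟨hP, by rwa [restrictTo_of_pos hP] at h⟩
  · exact absurd (restrictTo_of_neg hP) h

namespace IsMaximalEmbedding

variable {w : σ → ℤ} {Q : Set ℤ} {a : σ} {i : ℕ} {s : ℤ}

theorem mem (H : IsMaximalEmbedding w Q a) (j : σ) : w j ∈ Q := by
  simpa using H.add_mem 0 H.zero_mem j

theorem sub_notMem (H : IsMaximalEmbedding w Q a) (j : σ) (hj : j ≠ a) : w j - w a ∉ Q :=
  fun h => hj (H.eq_of_sub_mem j a h)

/-- The Apéry cells. -/
abbrev Cell (w : σ → ℤ) (Q : Set ℤ) (a : σ) (s : ℤ) (J : Finset σ) : Prop :=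
  a ∉ J ∧ s - ∑ g ∈ J, w g - w a ∉ Q

/-- The cells at which the remaining degree is a generator. -/
abbrev GenCell (w : σ → ℤ) (a : σ) (i : ℕ) (s : ℤ) (J : Finset σ) : Prop :=
  a ∉ J ∧ J.card = i ∧ ∃ j ≠ a, ∑ g ∈ J, w g + w j = s

/-- The cells at which the remaining degree is zero. -/
abbrev ZeroCell (w : σ → ℤ) (a : σ) (i : ℕ) (s : ℤ) (J : Finset σ) : Prop :=
  a ∉ J ∧ J.card = i ∧ ∑ g ∈ J, w g = s

theorem zeroCell_le (H : IsMaximalEmbedding w Q a) :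
    supportedOn k (ZeroCell w a (i + 1) s) ≤ divisorChains k w Q (i + 1) s := by
  intro c hc J hJ
  obtain ⟨-, hcard, hs⟩ := hc J hJ
  refine ⟨hcard, ?_⟩
  rw [hs, sub_self]
  exact H.zero_mem

end IsMaximalEmbedding

section

variable [LinearOrder σ]

theorem of_koszulContraction_ne_zero {a : σ} {c : Finset σ → k} {I : Finset σ}
    (h : koszulContraction a (AddMonoidHom.id k) c I ≠ 0) : a ∈ I ∧ c (I.erase a) ≠ 0 := by
  rw [koszulContraction] at h
  split_ifs at h with ha
  · refine ⟨ha, fun h0 => h ?_⟩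
    rw [h0, map_zero, smul_zero]
  · exact absurd rfl h

theorem sum_erase_add (w : σ → ℤ) {a : σ} {I : Finset σ} (h : a ∈ I) :
    ∑ g ∈ I, w g = ∑ g ∈ I.erase a, w g + w a := (Finset.sum_erase_add _ _ h).symm

theorem sum_insert_notMem (w : σ → ℤ) {a : σ} {I : Finset σ} (h : a ∉ I) :
    ∑ g ∈ insert a I, w g = w a + ∑ g ∈ I, w g := Finset.sum_insert h

end

variable [Fintype σ] [LinearOrder σ]

theorem exists_ne_zero_of_koszulD_ne_zero {c : Finset σ → k} {J : Finset σ}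
    (h : koszulD (1 : σ → k) c J ≠ 0) : ∃ l ∉ J, c (insert l J) ≠ 0 := by
  obtain ⟨l, hl, hne⟩ := Finset.exists_ne_zero_of_sum_ne_zero h
  refine ⟨l, Finset.mem_compl.1 hl, fun h0 => hne ?_⟩
  rw [h0, smul_zero, smul_zero]

/-- The value of the differential at `J.erase j` has a single possibly nonzero term, `c J` up to
sign. -/
theorem eq_zero_of_koszulD_eq_zero {c : Finset σ → k} {J : Finset σ} {j : σ} (hj : j ∈ J)
    (hl : ∀ l ∉ J.erase j, c (insert l (J.erase j)) ≠ 0 → l = j)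
    (h : koszulD (1 : σ → k) c (J.erase j) = 0) : c J = 0 := by
  rw [koszulD_apply, Finset.sum_eq_single j] at h
  · rw [Finset.insert_erase hj, Pi.one_apply, one_smul] at h
    have h2 := congrArg (fun x => koszulSign j (J.erase j) • x) h
    simpa only [smul_smul, koszulSign_mul_self, one_smul, smul_zero] using h2
  · intro l hlJ hlj
    by_contra hne
    refine hlj (hl l (Finset.mem_compl.1 hlJ) fun h0 => hne ?_)
    rw [h0, smul_zero, smul_zero]
  · intro h'
    simp at h'

/-- On the full simplex the contraction along `a` is a homotopy from the identity to zero. Homology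
of the divisor complex arises only where adding `a` leaves the complex, that is, at the Apéry cells.
-/
theorem koszulD_contraction (a : σ) (c : Finset σ → k) :
    koszulD (1 : σ → k) (koszulContraction a (AddMonoidHom.id k) c) =
      c - koszulContraction a (AddMonoidHom.id k) (koszulD (1 : σ → k) c) := by
  ext J
  rw [Pi.sub_apply, eq_sub_iff_add_eq, koszul_homotopy]
  · simp
  · simp
  · simp

namespace IsMaximalEmbedding

variable {w : σ → ℤ} {Q : Set ℤ} {a : σ} {i : ℕ} {s : ℤ}

theorem koszulD_mem (H : IsMaximalEmbedding w Q a) {c : Finset σ → k}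
    (hc : c ∈ divisorChains k w Q (i + 1) s) :
    koszulD (1 : σ → k) c ∈ divisorCycles k w Q i s := by
  refine ⟨fun J hJ => ?_, LinearMap.mem_ker.2 (koszulD_koszulD _ _)⟩
  obtain ⟨l, hl, hne⟩ := exists_ne_zero_of_koszulD_ne_zero hJ
  obtain ⟨hcard, hQ⟩ := hc _ hne
  rw [Finset.card_insert_of_notMem hl] at hcard
  rw [sum_insert_notMem w hl] at hQ
  refine ⟨by omega, ?_⟩
  have := H.add_mem _ hQ l
  rwa [show s - (w l + ∑ g ∈ J, w g) + w l = s - ∑ g ∈ J, w g by ring] at this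

/-- A cycle vanishes at a nonempty zero cell `J`: for `j ∈ J` the remaining degree at `J.erase j` is
`w j`, from which no other generator can be subtracted, so the cycle equation there isolates the
value at `J`. Conversely, a family `y` on generator cells is corrected to the cycle `D (h y) = y - h
(D y)`, with `h` the contraction along `a`. The correction lives on sets containing `a`, hence is
invisible on the cells, and stays in the complex because `w j + w l - w a ∈ Q`. -/
theorem map_restrictTo_cycles (H : IsMaximalEmbedding w Q a) (his : ¬ (i = 0 ∧ s = 0)) :
    (divisorCycles k w Q i s).map (restrictTo k (Cell w Q a s)) =
      supportedOn k (GenCell w a i s) := by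
  apply le_antisymm
  · rintro _ ⟨z, ⟨hz, hD⟩, rfl⟩ J hJ
    obtain ⟨⟨haJ, hQ⟩, hne⟩ := of_restrictTo_ne_zero hJ
    obtain ⟨hcard, hmem⟩ := hz J hne
    refine ⟨haJ, hcard, ?_⟩
    rcases H.eq_of_sub_notMem _ hmem hQ with h0 | ⟨j, hja, hj⟩
    · exfalso
      obtain ⟨j, hj⟩ : J.Nonempty := by
        rw [Finset.nonempty_iff_ne_empty]
        rintro rfl
        exact his ⟨by simpa using hcard.symm, by simpa using h0⟩
      refine hne (eq_zero_of_koszulD_eq_zero hj (fun l hl hlne => ?_)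
        (congrFun (LinearMap.mem_ker.1 hD) _))
      have h1 := (hz _ hlne).2
      rw [sum_insert_notMem w hl] at h1
      rw [sum_erase_add w hj] at h0
      refine (H.eq_of_sub_mem j l ?_).symm
      rwa [show w j - w l = s - (w l + ∑ g ∈ J.erase j, w g) by linarith]
    · exact ⟨j, hja, by linarith⟩
  · intro y hy
    refine ⟨y - koszulContraction a (AddMonoidHom.id k) (koszulD (1 : σ → k) y), ⟨?_, ?_⟩, ?_⟩
    · refine Submodule.sub_mem _ (fun J hJ => ?_) (fun I hI => ?_)
      · obtain ⟨-, hcard, j, -, hj⟩ := hy J hJ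
        refine ⟨hcard, ?_⟩
        rw [← hj, add_sub_cancel_left]
        exact H.mem j
      · obtain ⟨haI, hne⟩ := of_koszulContraction_ne_zero hI
        obtain ⟨l, hl, hlne⟩ := exists_ne_zero_of_koszulD_ne_zero hne
        obtain ⟨ha, hcard, j, hja, hj⟩ := hy _ hlne
        rw [Finset.mem_insert, not_or] at ha
        rw [Finset.card_insert_of_notMem hl, Finset.card_erase_add_one haI] at hcard
        refine ⟨hcard, ?_⟩
        rw [sum_insert_notMem w hl] at hj
        have := H.add_sub_mem j hja l (Ne.symm ha.1)
        rwa [sum_erase_add w haI, ← hj, show w l + ∑ g ∈ I.erase a, w g + w j -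
          (∑ g ∈ I.erase a, w g + w a) = w j + w l - w a by ring]
    · rw [SetLike.mem_coe, LinearMap.mem_ker, map_sub, koszulD_contraction, koszulD_koszulD]
      ext J
      simp [koszulContraction]
    · ext J
      by_cases hJ : Cell w Q a s J
      · rw [restrictTo_of_pos hJ, Pi.sub_apply, koszulContraction, if_neg hJ.1, sub_zero]
      · rw [restrictTo_of_neg hJ]
        by_contra hne
        obtain ⟨ha, -, j, hja, hj⟩ := hy J (Ne.symm hne)
        refine hJ ⟨ha, ?_⟩
        rw [← hj, add_sub_cancel_left]
        exact H.sub_notMem j hja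

/-- A cycle that vanishes on the Apéry cells is the boundary of its contraction along `a`, which
then stays in the complex. Conversely, at an Apéry cell a boundary depends only on the values of the
chain at zero cells, because products of two generators vanish modulo `a`. -/
theorem restrictTo_mem_iff (H : IsMaximalEmbedding w Q a) {z : Finset σ → k}
    (hz : z ∈ divisorCycles k w Q i s) :
    restrictTo k (Cell w Q a s) z ∈ (supportedOn k (ZeroCell w a (i + 1) s)).map
      (restrictTo k (Cell w Q a s) ∘ₗ koszulD (1 : σ → k)) ↔ z ∈ divisorBoundaries k w Q i s := by
  constructor
  · rintro ⟨c, hc, hcz⟩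
    have hc' := H.zeroCell_le hc
    obtain ⟨hy, hDy⟩ := Submodule.sub_mem _ hz (H.koszulD_mem hc')
    set y := z - koszulD (1 : σ → k) c with hydef
    have hπ : restrictTo k (Cell w Q a s) y = 0 := by
      rw [hydef, map_sub, ← hcz]
      exact sub_self _
    have hE : koszulContraction a (AddMonoidHom.id k) y ∈ divisorChains k w Q (i + 1) s := by
      intro I hI
      obtain ⟨haI, hne⟩ := of_koszulContraction_ne_zero hI
      refine ⟨by rw [← (hy _ hne).1, Finset.card_erase_add_one haI], ?_⟩
      by_contra hQ
      refine hne ?_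
      have := congrFun hπ (I.erase a)
      rwa [restrictTo_of_pos] at this
      refine ⟨Finset.notMem_erase _ _, ?_⟩
      rwa [sum_erase_add w haI, ← sub_sub] at hQ
    refine ⟨c + koszulContraction a (AddMonoidHom.id k) y, Submodule.add_mem _ hc' hE, ?_⟩
    rw [map_add, koszulD_contraction, LinearMap.mem_ker.1 hDy, hydef]
    ext J
    simp [koszulContraction]
  · rintro ⟨c, hc, rfl⟩
    refine ⟨restrictTo k (fun J => a ∉ J ∧ ∑ g ∈ J, w g = s) c, fun J hJ => ?_, ?_⟩
    · obtain ⟨⟨ha, hs⟩, hne⟩ := of_restrictTo_ne_zero hJ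
      exact ⟨ha, (hc J hne).1, hs⟩
    · rw [LinearMap.comp_apply, ← sub_eq_zero, ← map_sub, ← map_sub]
      ext J
      by_contra hJ
      obtain ⟨⟨haJ, hQ⟩, hne⟩ := of_restrictTo_ne_zero hJ
      obtain ⟨l, hl, hlne⟩ := exists_ne_zero_of_koszulD_ne_zero hne
      rw [Pi.sub_apply] at hlne
      have hcl : c (insert l J) ≠ 0 := by
        intro h0
        refine hlne ?_
        by_cases hP : a ∉ insert l J ∧ ∑ g ∈ insert l J, w g = s
        · rw [restrictTo_of_pos hP, sub_self]
        · rw [restrictTo_of_neg hP, h0, sub_zero]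
      obtain ⟨-, hu⟩ := hc _ hcl
      have hla : l ≠ a := by
        rintro rfl
        rw [sum_insert_notMem w hl, add_comm, ← sub_sub] at hu
        exact hQ hu
      have hu' : s - ∑ g ∈ insert l J, w g - w a ∉ Q := fun hu' => by
        have := H.add_mem _ hu' l
        rw [sum_insert_notMem w hl, show s - (w l + ∑ g ∈ J, w g) - w a + w l =
          s - ∑ g ∈ J, w g - w a by ring] at this
        exact hQ this
      -- The degree left at `insert l J` is in the Apéry set. If it were a generator `w j`, then `w
      -- j + w l - w a ∈ Q` would contradict that `J` is an Apéry cell.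
      rcases H.eq_of_sub_notMem _ hu hu' with h0 | ⟨j, hja, hj⟩
      · refine hlne ?_
        rw [restrictTo_of_pos, sub_self]
        exact ⟨by simp [haJ, Ne.symm hla], by linarith⟩
      · refine hQ ?_
        rw [sum_insert_notMem w hl] at hj
        have := H.add_sub_mem j hja l hla
        rwa [show w j + w l - w a = s - ∑ g ∈ J, w g - w a by linarith] at this

/-- A zero cell `J` has at least one element `j`, and `J.erase j` is an Apéry cell whose only zero
cell of the form `insert l (J.erase j)` is `J`, since distinct generators have distinct degrees. -/
theorem eq_zero_of_restrictTo_koszulD (H : IsMaximalEmbedding w Q a) {c : Finset σ → k}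
    (hc : c ∈ supportedOn k (ZeroCell w a (i + 1) s))
    (h : restrictTo k (Cell w Q a s) (koszulD (1 : σ → k) c) = 0) : c = 0 := by
  ext J
  by_contra hne
  obtain ⟨ha, hcard, hs⟩ := hc J hne
  obtain ⟨j, hj⟩ : J.Nonempty := Finset.card_pos.1 (by omega)
  have hja : j ≠ a := fun h => ha (h ▸ hj)
  rw [sum_erase_add w hj] at hs
  refine hne (eq_zero_of_koszulD_eq_zero hj (fun l hl hlne => ?_) ?_)
  · obtain ⟨-, -, hs'⟩ := hc _ hlne
    rw [sum_insert_notMem w hl] at hs'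
    refine (H.eq_of_sub_mem j l ?_).symm
    rw [show w j - w l = 0 by linarith]
    exact H.zero_mem
  · have := congrFun h (J.erase j)
    rwa [restrictTo_of_pos] at this
    refine ⟨fun h' => ha (Finset.mem_of_mem_erase h'), ?_⟩
    rw [← hs, add_sub_cancel_left]
    exact H.sub_notMem j hja

/-- The dimension of the homology of the divisor complex. -/
theorem finrank_homology_add (H : IsMaximalEmbedding w Q a) (his : ¬ (i = 0 ∧ s = 0)) :
    Module.finrank k (divisorCycles k w Q i s ⧸
      (divisorBoundaries k w Q i s).comap (divisorCycles k w Q i s).subtype) +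
      Nat.card {J // ZeroCell w a (i + 1) s J} = Nat.card {J // GenCell w a i s J} := by
  obtain ⟨e⟩ := nonempty_subquotient_equiv (restrictTo k (Cell w Q a s))
    (H.map_restrictTo_cycles (k := k) his) (fun z hz => H.restrictTo_mem_iff hz)
  rw [e.finrank_eq]
  set f := restrictTo k (Cell w Q a s) ∘ₗ koszulD (1 : σ → k) with hf
  have hle : (supportedOn k (ZeroCell w a (i + 1) s)).map f ≤ supportedOn k (GenCell w a i s) := by
    rw [← H.map_restrictTo_cycles his, hf, Submodule.map_comp]
    refine Submodule.map_mono ?_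
    rintro _ ⟨c, hc, rfl⟩
    exact H.koszulD_mem (H.zeroCell_le hc)
  -- The reduced boundary map is injective on zero cells, so its image has their number as
  -- dimension.
  have hrank : Module.finrank k ((supportedOn k (ZeroCell w a (i + 1) s)).map f) =
      Nat.card {J // ZeroCell w a (i + 1) s J} := by
    rw [← finrank_supportedOn (k := k), ← LinearMap.range_domRestrict]
    refine LinearMap.finrank_range_of_inj ?_
    rw [← LinearMap.ker_eq_bot, LinearMap.ker_eq_bot']
    intro c hc
    exact Subtype.ext (H.eq_zero_of_restrictTo_koszulD c.2 hc)
  rw [← hrank, ← finrank_supportedOn (k := k),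
    ← (Submodule.comapSubtypeEquivOfLe hle).finrank_eq]
  exact Submodule.finrank_quotient_add_finrank _

end IsMaximalEmbedding

end MaximalEmbeddingDimension

/-! ### Cell counts under a shift of the generators -/

section CellEquiv

open IsMaximalEmbedding

variable {σ τ : Type*} {w : σ → ℤ} {w' : τ → ℤ} {a : σ} {a' : τ} {μ : ℤ} (e : σ ≃ τ)

theorem sum_map_equiv (hw : ∀ g ≠ a, w' (e g) = w g + μ) {J : Finset σ} (hJ : a ∉ J) :
    ∑ g ∈ J.map e.toEmbedding, w' g = ∑ g ∈ J, w g + J.card * μ := by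
  rw [Finset.sum_map]
  calc ∑ g ∈ J, w' (e g) = ∑ g ∈ J, (w g + μ) :=
        Finset.sum_congr rfl fun g hg => hw g fun h => hJ (h ▸ hg)
    _ = _ := by rw [Finset.sum_add_distrib, Finset.sum_const, nsmul_eq_mul]

theorem mem_map_equiv_iff (ha : e a = a') {J : Finset σ} :
    a' ∈ J.map e.toEmbedding ↔ a ∈ J := by
  rw [← ha]
  exact Finset.mem_map' e.toEmbedding

theorem card_zeroCell_shift (ha : e a = a') (hw : ∀ g ≠ a, w' (e g) = w g + μ) (i : ℕ) (s : ℤ) :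
    Nat.card {J // ZeroCell w a i s J} = Nat.card {J // ZeroCell w' a' i (s + i * μ) J} := by
  refine Nat.card_congr (e.finsetCongr.subtypeEquiv fun J => ?_)
  rw [Equiv.finsetCongr_apply, ZeroCell, ZeroCell, mem_map_equiv_iff e ha, Finset.card_map]
  refine and_congr_right fun haJ => and_congr_right fun hcard => ?_
  rw [sum_map_equiv e hw haJ, hcard, add_left_inj]

/-- The `i` elements of `J` and the one remaining generator each contribute `μ`. -/
theorem card_genCell_shift (ha : e a = a') (hw : ∀ g ≠ a, w' (e g) = w g + μ) (i : ℕ) (s : ℤ) :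
    Nat.card {J // GenCell w a i s J} =
      Nat.card {J // GenCell w' a' i (s + ((i : ℤ) + 1) * μ) J} := by
  refine Nat.card_congr (e.finsetCongr.subtypeEquiv fun J => ?_)
  rw [Equiv.finsetCongr_apply, GenCell, GenCell, mem_map_equiv_iff e ha, Finset.card_map]
  refine and_congr_right fun haJ => and_congr_right fun hcard => ?_
  rw [sum_map_equiv e hw haJ, hcard]
  constructor
  · rintro ⟨j, hj, rfl⟩
    refine ⟨e j, fun h => hj (e.injective (h.trans ha.symm)), ?_⟩
    rw [hw j hj]
    ring
  · rintro ⟨j, hj, h⟩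
    have hj' : e.symm j ≠ a := fun h' => hj (by rw [← ha, ← h', e.apply_symm_apply])
    refine ⟨e.symm j, hj', ?_⟩
    have := hw _ hj'
    rw [e.apply_symm_apply] at this
    rw [this] at h
    linarith

end CellEquiv

/-! ### Arf semigroups and their blowups -/

section Semigroup

variable {S : AddSubmonoid ℕ}

theorem exists_minGens_le {u : ℕ} (hu : u ∈ S) (h0 : u ≠ 0) : ∃ g ∈ minGens S, g ≤ u := by
  induction u using Nat.strong_induction_on with
  | _ u ih =>
    by_cases h : ∃ a ∈ S, ∃ b ∈ S, a ≠ 0 ∧ b ≠ 0 ∧ u = a + b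
    · obtain ⟨a, ha, b, -, ha0, hb0, rfl⟩ := h
      obtain ⟨g, hg, hga⟩ := ih a (by omega) ha ha0
      exact ⟨g, hg, by omega⟩
    · exact ⟨u, ⟨hu, h0, h⟩, le_rfl⟩

theorem IsNumericalSemigroup.exists_ne_zero (hS : IsNumericalSemigroup (S : Set ℕ)) :
    ∃ u ∈ S, u ≠ 0 := by
  by_contra! h
  refine Set.infinite_univ (α := ℕ) ((hS.finite_compl.union (Set.finite_singleton 0)).subset ?_)
  intro u _
  by_cases hu : u ∈ S
  · exact Or.inr (h u hu)
  · exact Or.inl hu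

theorem IsNumericalSemigroup.multiplicity_mem (hS : IsNumericalSemigroup (S : Set ℕ)) :
    semigroupMultiplicity S ∈ minGens S := by
  obtain ⟨u, hu, h0⟩ := hS.exists_ne_zero
  obtain ⟨g, hg, -⟩ := exists_minGens_le hu h0
  exact Nat.sInf_mem ⟨g, hg⟩

theorem multiplicity_le {u : ℕ} (hu : u ∈ S) (h0 : u ≠ 0) : semigroupMultiplicity S ≤ u := by
  obtain ⟨g, hg, hgu⟩ := exists_minGens_le hu h0
  exact (Nat.sInf_le hg).trans hgu

theorem mem_shiftedSet_iff {n u : ℕ} : u ∈ shiftedSet S n ↔ u + n ∈ S := by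
  constructor
  · rintro ⟨s, hs, hns, rfl⟩
    rwa [Nat.sub_add_cancel hns]
  · exact fun h => ⟨u + n, h, Nat.le_add_left _ _, (Nat.add_sub_cancel _ _).symm⟩

theorem IsArfSemigroup.multiplicity_mem (hS : IsArfSemigroup S) : semigroupMultiplicity S ∈ S :=
  hS.1.multiplicity_mem.1

/-- For the multiplicity m, both a - m and b - m lie in S(m), which is closed under addition. -/
theorem IsArfSemigroup.exists_add_eq (hS : IsArfSemigroup S) {a b : ℕ} (ha : a ∈ S) (ha0 : a ≠ 0)
    (hb : b ∈ S) (hb0 : b ≠ 0) : ∃ c ∈ S, c + semigroupMultiplicity S = a + b := by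
  have h1 := multiplicity_le ha ha0
  have h2 := multiplicity_le hb hb0
  have := (hS.2 _ hS.multiplicity_mem).add_mem (a - semigroupMultiplicity S)
    (mem_shiftedSet_iff.2 (by rwa [Nat.sub_add_cancel h1])) (b - semigroupMultiplicity S)
    (mem_shiftedSet_iff.2 (by rwa [Nat.sub_add_cancel h2]))
  exact ⟨_, mem_shiftedSet_iff.1 this, by omega⟩

/-- The minimal generators of an Arf semigroup other than the multiplicity are the nonzero
elements of the Apéry set. -/
theorem IsArfSemigroup.mem_minGens_iff (hS : IsArfSemigroup S) {g : ℕ} :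
    (g ∈ minGens S ∧ g ≠ semigroupMultiplicity S) ↔
      g ∈ S ∧ g ≠ 0 ∧ ∀ v ∈ S, v + semigroupMultiplicity S ≠ g := by
  have hm := hS.1.multiplicity_mem
  constructor
  · rintro ⟨⟨hg, hg0, hdec⟩, hne⟩
    refine ⟨hg, hg0, fun v hv hvg => hdec ⟨v, hv, _, hm.1, ?_, hm.2.1, hvg.symm⟩⟩
    rintro rfl
    exact hne (by omega)
  · rintro ⟨hg, hg0, hv⟩
    refine ⟨⟨hg, hg0, ?_⟩, ?_⟩
    · rintro ⟨a, ha, b, hb, ha0, hb0, rfl⟩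
      obtain ⟨c, hc, hcab⟩ := hS.exists_add_eq ha ha0 hb hb0
      exact hv c hc hcab
    · rintro rfl
      exact hv 0 S.zero_mem (zero_add _)

/-- A generator other than the multiplicity m is a gap of `S` plus m, and there are finitely many
gaps. -/
theorem IsArfSemigroup.finite_minGens (hS : IsArfSemigroup S) : (minGens S).Finite := by
  refine ((hS.1.finite_compl.image (· + semigroupMultiplicity S)).union
    (Set.finite_singleton (semigroupMultiplicity S))).subset fun g hg => ?_
  by_cases h : g = semigroupMultiplicity S
  · exact Or.inr h
  · have hle := multiplicity_le hg.1 hg.2.1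
    refine Or.inl ⟨g - semigroupMultiplicity S, fun hmem => ?_, Nat.sub_add_cancel hle⟩
    exact (hS.mem_minGens_iff.1 ⟨hg, h⟩).2.2 _ hmem (Nat.sub_add_cancel hle)

theorem IsArfSemigroup.isMaximalEmbedding (hS : IsArfSemigroup S) :
    IsMaximalEmbedding (genWeight S) (intElements S)
      ⟨semigroupMultiplicity S, hS.1.multiplicity_mem⟩ where
  zero_mem := ⟨0, S.zero_mem, rfl⟩
  add_mem := by
    rintro _ ⟨u, hu, rfl⟩ l
    exact ⟨u + l, S.add_mem hu l.2.1, by rw [genWeight]; push_cast; rfl⟩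
  eq_of_sub_mem := by
    rintro j l ⟨u, hu, h⟩
    simp only [genWeight] at h
    by_cases hu0 : u = 0
    · refine Subtype.ext ?_
      omega
    · exact absurd ⟨u, hu, l, l.2.1, hu0, l.2.2.1, by omega⟩ j.2.2.2
  add_sub_mem := by
    rintro j _ l _
    obtain ⟨c, hc, h⟩ := hS.exists_add_eq j.2.1 j.2.2.1 l.2.1 l.2.2.1
    refine ⟨c, hc, ?_⟩
    simp only [genWeight]
    omega
  eq_of_sub_notMem := by
    rintro _ ⟨u, hu, rfl⟩ h
    by_cases hu0 : u = 0
    · exact Or.inl (by rw [hu0]; rfl)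
    · obtain ⟨hg, hne⟩ := hS.mem_minGens_iff.2 ⟨hu, hu0, fun v hv hvu => h ⟨v, hv, by
        simp only [genWeight]
        omega⟩⟩
      exact Or.inr ⟨⟨u, hg⟩, fun h => hne (congrArg Subtype.val h), rfl⟩

/-- The blowup is S(m): that set is closed under addition and contains the generators of the blowup,
and a strong induction on `u` gives the other inclusion. -/
theorem IsArfSemigroup.mem_blowup_iff (hS : IsArfSemigroup S) {u : ℕ} :
    u ∈ blowup S ↔ u + semigroupMultiplicity S ∈ S := by
  set m := semigroupMultiplicity S with hm
  have hgen : ∀ g ∈ minGens S, g - m ∈ blowup S := fun g hg =>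
    AddSubmonoid.subset_closure (Or.inr ⟨g, hg, rfl⟩)
  constructor
  · intro hu
    induction hu using AddSubmonoid.closure_induction with
    | mem x hx =>
      rcases hx with rfl | ⟨g, hg, rfl⟩
      · exact S.add_mem hS.multiplicity_mem hS.multiplicity_mem
      · change g - m + m ∈ S
        rw [Nat.sub_add_cancel (multiplicity_le hg.1 hg.2.1)]
        exact hg.1
    | zero => simpa using hS.multiplicity_mem
    | add x y _ _ hx hy =>
      exact mem_shiftedSet_iff.1 ((hS.2 m hS.multiplicity_mem).add_mem x
        (mem_shiftedSet_iff.2 hx) y (mem_shiftedSet_iff.2 hy))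
  · intro hu
    induction u using Nat.strong_induction_on with
    | _ u ih =>
      have hm0 : m ≠ 0 := hS.1.multiplicity_mem.2.1
      by_cases h : ∃ a ∈ S, ∃ b ∈ S, a ≠ 0 ∧ b ≠ 0 ∧ u + m = a + b
      · obtain ⟨a, ha, b, hb, ha0, hb0, hab⟩ := h
        have h1 := multiplicity_le ha ha0
        have h2 := multiplicity_le hb hb0
        have ha' := ih (a - m) (by omega) (by rwa [Nat.sub_add_cancel h1])
        have hb' := ih (b - m) (by omega) (by rwa [Nat.sub_add_cancel h2])
        have hmm : m ∈ blowup S := AddSubmonoid.subset_closure (Or.inl rfl)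
        -- The extra summand m is why the blowup needs m itself among its generators.
        rw [show u = a - m + (b - m) + m by omega]
        exact (blowup S).add_mem ((blowup S).add_mem ha' hb') hmm
      · have := hgen (u + m) ⟨hu, by omega, h⟩
        rwa [Nat.add_sub_cancel] at this

/-- With S' = S(m), the set S'(n) is S(n + m), and n + m ∈ S when n ∈ S'. -/
theorem IsArfSemigroup.blowup (hS : IsArfSemigroup S) : IsArfSemigroup (blowup S) := by
  have h1 : ((_root_.blowup S : AddSubmonoid ℕ) : Set ℕ) =
      shiftedSet S (semigroupMultiplicity S) := by
    ext u
    rw [SetLike.mem_coe, hS.mem_blowup_iff, mem_shiftedSet_iff]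
  refine ⟨h1 ▸ hS.2 _ hS.multiplicity_mem, fun n hn => ?_⟩
  have h2 : shiftedSet (_root_.blowup S) n = shiftedSet S (n + semigroupMultiplicity S) := by
    ext u
    rw [mem_shiftedSet_iff, mem_shiftedSet_iff, hS.mem_blowup_iff, add_assoc]
  exact h2 ▸ hS.2 _ (hS.mem_blowup_iff.1 hn)

/-- If the blowup has the same multiplicity, then its other generators are those of the
semigroup, shifted by the multiplicity. -/
theorem IsArfSemigroup.mem_minGens_blowup_iff (hS : IsArfSemigroup S)
    (hmult : semigroupMultiplicity (_root_.blowup S) = semigroupMultiplicity S) {g : ℕ} :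
    (g ∈ minGens (_root_.blowup S) ∧ g ≠ semigroupMultiplicity S) ↔
      (g + semigroupMultiplicity S ∈ minGens S ∧ g ≠ 0) := by
  have hm0 : semigroupMultiplicity S ≠ 0 := hS.1.multiplicity_mem.2.1
  have hB := hS.blowup.mem_minGens_iff (g := g)
  rw [hmult] at hB
  have hA := hS.mem_minGens_iff (g := g + semigroupMultiplicity S)
  rw [hB]
  have : (g + semigroupMultiplicity S ∈ minGens S ∧ g ≠ 0) ↔
      (g + semigroupMultiplicity S ∈ minGens S ∧
        g + semigroupMultiplicity S ≠ semigroupMultiplicity S) :=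
    and_congr_right fun _ => by omega
  rw [this, hA, hS.mem_blowup_iff]
  -- Both Apéry conditions amount to `g ∉ S`: a nonzero `g ∈ S` is at least m, and then `g - m` lies
  -- in the blowup.
  refine and_congr_right fun hg => ⟨fun ⟨h0, hv⟩ => ⟨by omega, fun v hv' hvg => ?_⟩,
    fun ⟨_, hv⟩ => ⟨?_, fun v hv' hvg => ?_⟩⟩
  · obtain rfl : v = g := by omega
    have hle := multiplicity_le hv' h0
    exact hv (v - semigroupMultiplicity S)
      (hS.mem_blowup_iff.2 (by rwa [Nat.sub_add_cancel hle])) (Nat.sub_add_cancel hle)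
  · rintro rfl
    exact hv 0 S.zero_mem rfl
  · exact hv g (hvg ▸ hS.mem_blowup_iff.1 hv') rfl

/-- The bijection between the generators of the blowup and those of the semigroup. -/
theorem IsArfSemigroup.exists_minGens_equiv (hS : IsArfSemigroup S)
    (hmult : semigroupMultiplicity (_root_.blowup S) = semigroupMultiplicity S) :
    ∃ e : minGens (_root_.blowup S) ≃ minGens S,
      e ⟨_, hS.blowup.1.multiplicity_mem⟩ = ⟨_, hS.1.multiplicity_mem⟩ ∧
      ∀ g ≠ (⟨_, hS.blowup.1.multiplicity_mem⟩ : minGens (_root_.blowup S)),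
        genWeight S (e g) = genWeight (_root_.blowup S) g + (semigroupMultiplicity S : ℤ) := by
  classical
  have hm := hS.1.multiplicity_mem
  have hm' : semigroupMultiplicity S ∈ minGens (_root_.blowup S) :=
    hmult ▸ hS.blowup.1.multiplicity_mem
  set m := semigroupMultiplicity S with hmdef
  have hto : ∀ g ∈ minGens (_root_.blowup S), (if g = m then m else g + m) ∈ minGens S := by
    intro g hg
    split_ifs with h
    · exact hm
    · exact ((hS.mem_minGens_blowup_iff hmult).1 ⟨hg, h⟩).1
  have hinv : ∀ g ∈ minGens S, (if g = m then m else g - m) ∈ minGens (_root_.blowup S) := by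
    intro g hg
    have hle := multiplicity_le hg.1 hg.2.1
    split_ifs with h
    · exact hm'
    · refine ((hS.mem_minGens_blowup_iff hmult).2 ⟨?_, by omega⟩).1
      rwa [Nat.sub_add_cancel hle]
  have hne : ∀ g ∈ minGens (_root_.blowup S), g ≠ 0 := fun g hg => hg.2.1
  refine ⟨⟨fun g => ⟨_, hto g g.2⟩, fun g => ⟨_, hinv g g.2⟩, fun g => ?_, fun g => ?_⟩, ?_, ?_⟩
  · refine Subtype.ext ?_
    change (if (if (g : ℕ) = m then m else (g : ℕ) + m) = m then m
      else (if (g : ℕ) = m then m else (g : ℕ) + m) - m) = (g : ℕ)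
    have := hne g g.2
    split_ifs <;> omega
  · refine Subtype.ext ?_
    change (if (if (g : ℕ) = m then m else (g : ℕ) - m) = m then m
      else (if (g : ℕ) = m then m else (g : ℕ) - m) + m) = (g : ℕ)
    have hle := multiplicity_le g.2.1 g.2.2.1
    by_cases h : (g : ℕ) = m
    · simp [h]
    · have h' := (hS.mem_minGens_blowup_iff hmult (g := g - m)).2
        ⟨by rw [Nat.sub_add_cancel hle]; exact g.2, by omega⟩
      rw [if_neg h, if_neg h'.2, Nat.sub_add_cancel hle]
  · exact Subtype.ext (if_pos hmult)
  · intro g hg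
    have : (g : ℕ) ≠ m := fun h => hg (Subtype.ext (h.trans hmult.symm))
    change (((if (g : ℕ) = m then m else (g : ℕ) + m : ℕ)) : ℤ) = ((g : ℕ) : ℤ) + (m : ℤ)
    rw [if_neg this]
    push_cast
    rfl

end Semigroup

end

theorem mainTheorem1 (k : Type*) [Field k] (S : AddSubmonoid ℕ) (hS : IsArfSemigroup S)
    (hmult : semigroupMultiplicity (blowup S) = semigroupMultiplicity S)
    (i : ℕ) (s : ℤ)
    (his : i = 0 → s ≠ 0 ∧ s ≠ -(semigroupMultiplicity S : ℤ)) :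
    gradedBetti k (blowup S) i s
      = gradedBetti k S i (s + ((i : ℤ) + 1) * (semigroupMultiplicity S : ℤ)) := by
  have := hS.finite_minGens.fintype
  have := hS.blowup.finite_minGens.fintype
  obtain ⟨e, he, hw⟩ := hS.exists_minGens_equiv hmult
  rw [gradedBetti_eq_finrank, gradedBetti_eq_finrank]
  have h1 := hS.blowup.isMaximalEmbedding.finrank_homology_add (k := k) (i := i) (s := s)
    fun h => (his h.1).1 h.2
  have h2 := hS.isMaximalEmbedding.finrank_homology_add (k := k) (i := i)
    (s := s + ((i : ℤ) + 1) * (semigroupMultiplicity S : ℤ)) (by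
      -- The exceptional pair (0, 0) for `S` is the pair (0, -m) for the blowup.
      rintro ⟨rfl, h⟩
      refine (his rfl).2 ?_
      push_cast at h
      linarith)
  -- Zero cells with `i + 1` elements and generator cells with `i` elements shift by the same
  -- amount, so the two dimension formulas have equal counts.
  have h3 := card_zeroCell_shift e he hw (i + 1) s
  have h4 := card_genCell_shift e he hw i s
  push_cast at h3
  omega
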